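/- All graphs are finite and simple. Let $\Gamma$ be a graph and let $G\leqslant\mathrm{Aut}\,\Gamma$ be transitive on the arcs (ordered pairs of adjacent vertices) of $\Gamma$. A block system of $G$ is a $G$-invariant partition $\mathcal B$ of the vertex set, different from the partition into singletons and from the partition with a single part. The quotient graph $\Gamma_{\mathcal B}$ has vertex set $\mathcal B$, and distinct blocks $B,C$ are adjacent if and only if some vertex of $B$ is adjacent in $\Gamma$ to some vertex of $C$. Then $\Gamma$ is a *cover* of $\Gamma_{\mathcal B}$ if, for each arc $(B,C)$ of $\Gamma_{\mathcal B}$, the subgraph of $\Gamma$ induced on $B\cup C$ is a perfect matching between $B$ and $C$; and $\Gamma$ is a *pseudocover* of $\Gamma_{\mathcal B}$ if $\Gamma$ and $\Gamma_{\mathcal B}$ are regular of the same valency but $\Gamma$ is not a cover of $\Gamma_{\mathcal B}$. A *symmetric pseudocover* of $\mathbf K_n$ is a graph $\Gamma$ which, for some such $G$ and $\mathcal B$ with $\Gamma_{\mathcal B}\cong\mathbf K_n$, is a pseudocover of $\Gamma_{\mathcal B}$. A *$G$-arc-transitive cover* (respectively *pseudocover*) *of $\mathbf K_n$ with $G\leqslant\mathrm{Aut}\,\mathbf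 K_n=\mathrm S_n$* is a graph $\Gamma$ which is a cover (respectively pseudocover) of some such $\Gamma_{\mathcal B}\cong\mathbf K_n$, where moreover $G$ acts faithfully on $\mathcal B$, so that $G$ is identified with a subgroup of $\mathrm S_n$. **Corollary.** 1. $\mathbf K_4$ has no connected symmetric pseudocover. Up to isomorphism, the cube graph is the unique connected graph that is a $G$-arc-transitive cover of $\mathbf K_4$ for some $G\leqslant\mathrm S_4$. 2. Up to isomorphism of graphs, there is exactly one connected graph that is a $G$-arc-transitive pseudocover of $\mathbf K_5$ for some $G\leqslant\mathrm S_5$, and there are exactly $5$ connected graphs that are $G$-arc-transitive covers of $\mathbf K_5$ for some $G\leqslant\mathrm S_5$. -/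

import Mathlib

universe u

namespace GraphCover

variable {V W : Type*}

/-- The subgroup `G` of `Aut Γ` is transitive on the arcs (ordered pairs of adjacent vertices)
of `Γ`. -/
def IsArcTransitive (Γ : SimpleGraph V) (G : Subgroup (Γ ≃g Γ)) : Prop :=
  ∀ ⦃a b c d : V⦄, Γ.Adj a b → Γ.Adj c d → ∃ g ∈ G, g a = c ∧ g b = d

/-- A block system of `G`: a `G`-invariant partition of the vertex set (given by its equivalence
relation) which is neither the partition into singletons nor the partition with one part. -/
structure IsBlockSystem (Γ : SimpleGraph V) (G : Subgroup (Γ ≃g Γ)) (r : Setoid V) : Prop where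
  invariant : ∀ g ∈ G, ∀ a b : V, r a b → r (g a) (g b)
  ne_bot : r ≠ ⊥
  ne_top : r ≠ ⊤

/-- The set of vertices that make up a block. -/
def block (r : Setoid V) (B : Quotient r) : Set V := {v | Quotient.mk r v = B}

/-- The quotient graph: its vertices are the blocks, and two distinct blocks are adjacent when
some vertex of the first is adjacent to some vertex of the second. -/
def quotientGraph (Γ : SimpleGraph V) (r : Setoid V) : SimpleGraph (Quotient r) where
  Adj B C := B ≠ C ∧ ∃ b ∈ block r B, ∃ c ∈ block r C, Γ.Adj b c
  symm := ⟨fun _ _ ⟨hne, b, hb, c, hc, h⟩ => ⟨hne.symm, c, hc, b, hb, h.symm⟩⟩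
  loopless := ⟨fun _ h => h.1 rfl⟩

/-- `Γ` is a cover of its quotient: for each arc `(B, C)` of the quotient graph, the subgraph
induced by `Γ` on `B ∪ C` is a perfect matching between `B` and `C`. -/
def IsCoverOfQuotient (Γ : SimpleGraph V) (r : Setoid V) : Prop :=
  ∀ B C : Quotient r, (quotientGraph Γ r).Adj B C →
    ((⊤ : Γ.Subgraph).induce (block r B ∪ block r C)).IsMatching ∧
    ((⊤ : Γ.Subgraph).induce (block r B ∪ block r C)).spanningCoe.IsBipartiteWith
      (block r B) (block r C)

/-- `Γ` is regular of valency `k`. -/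
def HasValency (Γ : SimpleGraph V) (k : ℕ) : Prop :=
  ∀ v : V, (Γ.neighborSet v).encard = k

/-- `Γ` is a pseudocover of its quotient: they have the same valency, but `Γ` is not a cover. -/
def IsPseudocoverOfQuotient (Γ : SimpleGraph V) (r : Setoid V) : Prop :=
  (∃ k : ℕ, HasValency Γ k ∧ HasValency (quotientGraph Γ r) k) ∧ ¬ IsCoverOfQuotient Γ r

/-- `G` acts faithfully on the set of blocks. Thus, when the quotient graph is isomorphic to `K_n`,
the group `G` is identified with a subgroup of `Aut K_n = S_n`. -/
def IsFaithfulOnBlocks (Γ : SimpleGraph V) (G : Subgroup (Γ ≃g Γ)) (r : Setoid V) : Prop :=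
  ∀ g ∈ G, (∀ v : V, r (g v) v) → g = 1

/-- `Γ` is a symmetric pseudocover of `Δ`: for some group `G` of automorphisms which is transitive
on the arcs of `Γ` and some block system of `G`, the quotient graph is isomorphic to `Δ` and `Γ` is
a pseudocover of it. -/
def IsSymmetricPseudocover (Γ : SimpleGraph V) (Δ : SimpleGraph W) : Prop :=
  ∃ (G : Subgroup (Γ ≃g Γ)) (r : Setoid V),
    IsArcTransitive Γ G ∧ IsBlockSystem Γ G r ∧ Nonempty (quotientGraph Γ r ≃g Δ) ∧
      IsPseudocoverOfQuotient Γ r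

/-- `Γ` is a `G`-arc-transitive cover of `Δ` for some `G ≤ Aut Δ`. -/
def IsFaithfulArcTransitiveCover (Γ : SimpleGraph V) (Δ : SimpleGraph W) : Prop :=
  ∃ (G : Subgroup (Γ ≃g Γ)) (r : Setoid V),
    IsArcTransitive Γ G ∧ IsBlockSystem Γ G r ∧ IsFaithfulOnBlocks Γ G r ∧
      Nonempty (quotientGraph Γ r ≃g Δ) ∧ IsCoverOfQuotient Γ r

/-- `Γ` is a `G`-arc-transitive pseudocover of `Δ` for some `G ≤ Aut Δ`. -/
def IsFaithfulArcTransitivePseudocover (Γ : SimpleGraph V) (Δ : SimpleGraph W) : Prop :=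
  ∃ (G : Subgroup (Γ ≃g Γ)) (r : Setoid V),
    IsArcTransitive Γ G ∧ IsBlockSystem Γ G r ∧ IsFaithfulOnBlocks Γ G r ∧
      Nonempty (quotientGraph Γ r ≃g Δ) ∧ IsPseudocoverOfQuotient Γ r

/-- The complete graph `K_n`. -/
abbrev K (n : ℕ) : SimpleGraph (Fin n) := SimpleGraph.completeGraph (Fin n)

/-- The cube graph: vertices are the binary words of length 3, adjacent when they differ in exactly
one coordinate. -/
def cubeGraph : SimpleGraph (Fin 3 → Bool) where
  Adj x y := hammingDist x y = 1
  symm := ⟨fun x y h => (hammingDist_comm y x).trans h⟩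
  loopless := ⟨fun x h => by simp at h⟩

end GraphCover

/-! Read the group, acting faithfully on the blocks, as a subgroup of `S_n`. A connected
arc-transitive graph is determined by the stabilizer `H` of a vertex in block 0 and one element `g`
carrying that vertex to a neighbour in block 1: it is the graph on the cosets of `H` given by the
double coset `H g H`. The classification thus becomes one of pairs `(H, g)` up to conjugation,
settled by finite checks in `S_4` and `S_5`.

For covers, a neighbour is determined by its block, so `H` fixes 0 and is transitive on the other
points; `g` may be taken to swap 0 and 1. Pairs lying in a group whose stabilizer of 0 is already
inside `H` would force singleton blocks and are discarded (`CoverSetup.not_forall_mem_fixer`). For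
`n = 4` there remain `H = C_3` and `g = (0 1)`, which give the cube. For `n = 5`, `H` contains the
Klein group `V_4` or a 4-cycle. An even `g` may generate only `A_5`, but `CoverSetup.nonempty_iso`
identifies such a graph with a coset graph of `S_5`. The list is `A_4`, `D_8`, `V_4`, `C_4` with `g
= (0 1)`, and `C_4` with `g = (0 1)(2 3)`. The graphs have 10, 15, 30, 30, 30 vertices, and the last
three are separated by closed 5-walks and triangles.

For pseudocovers, arc-transitivity gives every vertex at least two neighbours in each block that it
sees, and connectedness gives a vertex that sees two blocks. So the valency is at least 4, which
excludes `K_4`. Over `K_5` the neighbours split two and two; this forces `H = ⟨(1 2), (3 4)⟩`, and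
then `g` up to conjugation (`BlockAction.nonempty_iso_pseudocover_of_neighbors`). -/

namespace GraphCover

open Equiv

/-! ### Locally transitive actions and actions over a complete quotient -/

section Actions

variable {V W A P X : Type*} [Group A] [MulAction A V] [Group P] [MulAction P W]

/-- The group `A` acts on the graph `Γ` by automorphisms, and the stabilizer of `v₀` acts
transitively on the neighbours of `v₀`, one of which is `g • v₀`. -/
structure LocallyTransitive (Γ : SimpleGraph V) (A : Type*) [Group A] [MulAction A V]
    (v₀ : V) (g : A) : Prop where
  adj_smul : ∀ (a : A) {v w : V}, Γ.Adj v w → Γ.Adj (a • v) (a • w)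
  adj_base : Γ.Adj v₀ (g • v₀)
  exists_of_adj : ∀ {w : V}, Γ.Adj v₀ w → ∃ a : A, a • v₀ = v₀ ∧ a • g • v₀ = w

/-- Induction along a walk: a neighbour of `t • v₀` is the image under `t` of a neighbour of `v₀`,
hence is again reached from `v₀` by `T`. -/
theorem exists_mem_smul_eq {Γ : SimpleGraph V} (hc : Γ.Connected)
    (hadj : ∀ (a : A) {v w : V}, Γ.Adj v w → Γ.Adj (a • v) (a • w)) (v₀ : V) (T : Subgroup A)
    (hT : ∀ w, Γ.Adj v₀ w → ∃ t ∈ T, t • v₀ = w) (v : V) : ∃ t ∈ T, t • v₀ = v := by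
  obtain ⟨p⟩ := hc.preconnected v v₀
  induction p with
  | nil => exact ⟨1, T.one_mem, one_smul _ _⟩
  | @cons u v w h p ih =>
    obtain ⟨t, ht, rfl⟩ := ih hT
    have h2 := hadj t⁻¹ h.symm
    rw [inv_smul_smul] at h2
    obtain ⟨s, hs, hs2⟩ := hT _ h2
    exact ⟨t * s, T.mul_mem ht hs, by rw [mul_smul, hs2, smul_inv_smul]⟩

theorem adj_smul_iff {Γ : SimpleGraph V}
    (hadj : ∀ (a : A) {v w : V}, Γ.Adj v w → Γ.Adj (a • v) (a • w)) (a : A) {v w : V} :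
    Γ.Adj (a • v) (a • w) ↔ Γ.Adj v w :=
  ⟨fun h => by simpa using hadj a⁻¹ h, hadj a⟩

namespace LocallyTransitive

variable {Γ : SimpleGraph V} {v₀ : V} {g : A}

theorem exists_smul_eq (h : LocallyTransitive Γ A v₀ g) (hc : Γ.Connected) (v : V) :
    ∃ a : A, a • v₀ = v := by
  obtain ⟨a, -, ha⟩ := exists_mem_smul_eq hc h.adj_smul v₀ ⊤ (fun w hw => by
    obtain ⟨a, -, ha⟩ := h.exists_of_adj hw
    exact ⟨a * g, trivial, by rw [mul_smul, ha]⟩) v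
  exact ⟨a, ha⟩

theorem arc_transitive (h : LocallyTransitive Γ A v₀ g) (hc : Γ.Connected) {a b c d : V}
    (hab : Γ.Adj a b) (hcd : Γ.Adj c d) : ∃ s : A, s • a = c ∧ s • b = d := by
  have key : ∀ {a b : V}, Γ.Adj a b → ∃ s : A, s • v₀ = a ∧ s • g • v₀ = b := by
    intro a b hab
    obtain ⟨s, rfl⟩ := h.exists_smul_eq hc a
    have h2 := h.adj_smul s⁻¹ hab
    rw [inv_smul_smul] at h2
    obtain ⟨t, ht, ht2⟩ := h.exists_of_adj h2
    exact ⟨s * t, by rw [mul_smul, ht], by rw [mul_smul, ht2, smul_inv_smul]⟩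
  obtain ⟨s, rfl, rfl⟩ := key hab
  obtain ⟨t, rfl, rfl⟩ := key hcd
  exact ⟨t * s⁻¹, by simp [mul_smul], by simp [mul_smul]⟩

/-- Two connected graphs with locally transitive actions are isomorphic when the actions are
compatible with a homomorphism that matches up the vertex stabilizers. -/
theorem nonempty_iso {Δ : SimpleGraph W} {w₀ : W} {γ : P} (h : LocallyTransitive Γ A v₀ g)
    (hc : Γ.Connected) (h' : LocallyTransitive Δ P w₀ γ) (hc' : Δ.Connected) (φ : A →* P)
    (hstab : ∀ a : A, a • v₀ = v₀ ↔ φ a • w₀ = w₀) (hg : φ g • w₀ = γ • w₀)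
    (hloc : ∀ p : P, p • w₀ = w₀ → ∃ a : A, a • v₀ = v₀ ∧ φ a • γ • w₀ = p • γ • w₀) :
    Nonempty (Γ ≃g Δ) := by
  -- The isomorphism is `a • v₀ ↦ φ a • w₀`. Matching stabilizers make it well defined and
  -- injective. It is onto because the range of `φ` already reaches all neighbours of `w₀`; `φ`
  -- itself need not be surjective.
  have heq : ∀ a b : A, a • v₀ = b • v₀ ↔ φ a • w₀ = φ b • w₀ := by
    intro a b
    have h1 := hstab (b⁻¹ * a)
    rw [map_mul, map_inv, mul_smul, mul_smul, inv_smul_eq_iff, inv_smul_eq_iff] at h1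
    exact h1
  choose f hf using h.exists_smul_eq hc
  have hfa : ∀ a : A, φ (f (a • v₀)) • w₀ = φ a • w₀ := fun a => (heq _ _).1 (hf _)
  have hsurj : ∀ w : W, ∃ a : A, φ a • w₀ = w := by
    intro w
    obtain ⟨_, ⟨a, rfl⟩, ha⟩ := exists_mem_smul_eq hc' h'.adj_smul w₀ φ.range (fun w hw => by
      obtain ⟨p, hp, rfl⟩ := h'.exists_of_adj hw
      obtain ⟨a, ha, ha'⟩ := hloc p hp
      exact ⟨φ (a * g), ⟨_, rfl⟩, by rw [map_mul, mul_smul, hg, ha']⟩) w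
    exact ⟨a, ha⟩
  have hadj0 : ∀ a : A, Δ.Adj w₀ (φ a • w₀) ↔ Γ.Adj v₀ (a • v₀) := by
    intro a
    constructor
    · intro hh
      obtain ⟨p, hp, hp2⟩ := h'.exists_of_adj hh
      obtain ⟨s, hs, hs2⟩ := hloc p hp
      have : a • v₀ = (s * g) • v₀ := by
        rw [heq, map_mul, mul_smul, hg, hs2, hp2]
      rw [this, mul_smul]
      simpa [hs] using h.adj_smul s h.adj_base
    · intro hh
      obtain ⟨s, hs, hs2⟩ := h.exists_of_adj hh
      rw [← mul_smul, heq, map_mul, mul_smul, hg] at hs2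
      rw [← hs2]
      simpa [(hstab s).1 hs] using h'.adj_smul (φ s) h'.adj_base
  have hbij : Function.Bijective (fun v => φ (f v) • w₀) := by
    constructor
    · intro v w hvw
      rw [← hf v, ← hf w, heq]
      exact hvw
    · intro w
      obtain ⟨a, rfl⟩ := hsurj w
      exact ⟨a • v₀, hfa a⟩
  refine ⟨⟨Equiv.ofBijective _ hbij, ?_⟩⟩
  intro v w
  change Δ.Adj (φ (f v) • w₀) (φ (f w) • w₀) ↔ _
  conv_rhs => rw [← hf v, ← hf w]
  rw [← adj_smul_iff h.adj_smul (f v)⁻¹, ← adj_smul_iff h'.adj_smul (φ (f v))⁻¹, inv_smul_smul,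
    inv_smul_smul, ← mul_smul, ← mul_smul, ← hadj0, map_mul, map_inv]

end LocallyTransitive

/-- A group acting on the graph `Γ`, transitively on arcs, compatibly with its permutation action
`φ` on the set `X` of parts of a complete quotient of `Γ`, with quotient map `π`. -/
structure BlockAction (Γ : SimpleGraph V) (φ : A →* Perm X) (π : V → X) : Prop where
  adj_smul : ∀ (a : A) {v w : V}, Γ.Adj v w → Γ.Adj (a • v) (a • w)
  arc_transitive : ∀ {a b c d : V}, Γ.Adj a b → Γ.Adj c d → ∃ s : A, s • a = c ∧ s • b = d
  map_smul : ∀ (a : A) (v : V), π (a • v) = φ a (π v)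
  not_injective : ¬ Function.Injective π
  exists_adj : ∀ {i j : X}, i ≠ j → ∃ v w, Γ.Adj v w ∧ π v = i ∧ π w = j

/-- Every vertex has exactly one neighbour in each other fibre of `π`. -/
def UniqueLifting (Γ : SimpleGraph V) (π : V → X) : Prop :=
  ∀ v j, j ≠ π v → ∃! w, Γ.Adj v w ∧ π w = j

namespace BlockAction

variable {Γ : SimpleGraph V} {φ : A →* Perm X} {π : V → X}

theorem surjective [Nontrivial X] (h : BlockAction Γ φ π) : Function.Surjective π := by
  intro i
  obtain ⟨j, hj⟩ := exists_ne i
  obtain ⟨v, w, -, hv, -⟩ := h.exists_adj hj.symm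
  exact ⟨v, hv⟩

/-- Some edge joins two different parts, and all arcs are alike under the group. -/
theorem map_ne [Nontrivial X] (h : BlockAction Γ φ π) {v w : V} (hvw : Γ.Adj v w) :
    π v ≠ π w := by
  obtain ⟨i, j, hij⟩ := exists_pair_ne X
  obtain ⟨x, y, hxy, hx, hy⟩ := h.exists_adj hij
  obtain ⟨s, rfl, rfl⟩ := h.arc_transitive hxy hvw
  rw [h.map_smul, h.map_smul, hx, hy]
  exact fun e => hij ((φ s).injective e)

/-- Renaming the parts conjugates the permutations, which later brings them into normal form. -/
theorem relabel (h : BlockAction Γ φ π) (τ : Perm X) :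
    BlockAction Γ ((MulAut.conj τ).toMonoidHom.comp φ) (τ ∘ π) where
  adj_smul := h.adj_smul
  arc_transitive := h.arc_transitive
  map_smul a v := by simp [h.map_smul]
  not_injective hi := h.not_injective hi.of_comp
  exists_adj {i j} hij := by
    obtain ⟨v, w, hvw, hv, hw⟩ := h.exists_adj (τ⁻¹.injective.ne hij)
    exact ⟨v, w, hvw, by simp [hv], by simp [hw]⟩

theorem locallyTransitive (h : BlockAction Γ φ π) {v₀ : V} {g : A} (hg : Γ.Adj v₀ (g • v₀)) :
    LocallyTransitive Γ A v₀ g :=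
  ⟨h.adj_smul, hg, fun hw => h.arc_transitive hg hw⟩

end BlockAction

theorem UniqueLifting.relabel {Γ : SimpleGraph V} {π : V → X} (h : UniqueLifting Γ π)
    (τ : Perm X) : UniqueLifting Γ (τ ∘ π) := by
  intro v j hj
  obtain ⟨w, ⟨hw, hwj⟩, hu⟩ := h v (τ⁻¹ j) (fun e => hj (by simp [← e]))
  refine ⟨w, ⟨hw, by simp [hwj]⟩, fun y hy => hu y ⟨hy.1, ?_⟩⟩
  rw [← hy.2]; simp

end Actions

/-! ### Translation between block systems and maps to the set of parts -/

section Quotients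

variable {V W A X : Type*}

/-- All pairs of blocks are adjacent and no edge lies inside a block, so a perfect matching for each
pair means exactly one neighbour in every other block. -/
theorem isCoverOfQuotient_iff {Γ : SimpleGraph V} {r : Setoid V} {π : V → X}
    (hsurj : Function.Surjective π)
    (hr : ∀ v w, r v w ↔ π v = π w) (hne : ∀ {v w}, Γ.Adj v w → π v ≠ π w)
    (hex : ∀ {i j : X}, i ≠ j → ∃ v w, Γ.Adj v w ∧ π v = i ∧ π w = j) :
    IsCoverOfQuotient Γ r ↔ UniqueLifting Γ π := by
  have hblock : ∀ v w, w ∈ block r (Quotient.mk r v) ↔ π w = π v := fun v w => by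
    rw [← hr]; exact Quotient.eq
  have hqadj : ∀ v w, π v ≠ π w → (quotientGraph Γ r).Adj (Quotient.mk r v) (Quotient.mk r w) := by
    intro v w hvw
    obtain ⟨x, y, hxy, hx, hy⟩ := hex hvw
    exact ⟨fun h => hvw ((hr _ _).1 (Quotient.exact h)), x, (hblock v x).2 hx, y,
      (hblock w y).2 hy, hxy⟩
  constructor
  · intro h v j hj
    obtain ⟨u, rfl⟩ := hsurj j
    obtain ⟨hm, -⟩ := h _ _ (hqadj v u hj.symm)
    obtain ⟨w, hw, huw⟩ := hm (v := v) (Or.inl ((hblock v v).2 rfl))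
    have hmem : ∀ y, ((⊤ : Γ.Subgraph).induce (block r (Quotient.mk r v) ∪
        block r (Quotient.mk r u))).Adj v y ↔ Γ.Adj v y ∧ π y = π u := by
      intro y
      simp only [SimpleGraph.Subgraph.induce_adj, SimpleGraph.Subgraph.top_adj, Set.mem_union,
        hblock]
      constructor
      · rintro ⟨-, h1 | h1, h2⟩
        · exact absurd h1.symm (hne h2)
        · exact ⟨h2, h1⟩
      · rintro ⟨h1, h2⟩
        exact ⟨Or.inl trivial, Or.inr h2, h1⟩
    exact ⟨w, (hmem w).1 hw, fun y hy => huw y ((hmem y).2 hy)⟩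
  · intro h B C hBC
    induction B using Quotient.inductionOn with | _ b =>
    induction C using Quotient.inductionOn with | _ c =>
    have hbc : π b ≠ π c := fun e => hBC.1 (Quotient.sound ((hr _ _).2 e))
    constructor
    · intro v hv
      simp only [SimpleGraph.Subgraph.induce_adj, SimpleGraph.Subgraph.top_adj, Set.mem_union,
        hblock, SimpleGraph.Subgraph.induce_verts] at hv ⊢
      rcases hv with hv | hv
      · obtain ⟨w, ⟨hw, hwc⟩, hu⟩ := h v (π c) (by rw [hv]; exact hbc.symm)
        refine ⟨w, ⟨Or.inl hv, Or.inr hwc, hw⟩, ?_⟩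
        rintro y ⟨-, h1 | h1, h2⟩
        · exact absurd (hv.trans h1.symm) (hne h2)
        · exact hu y ⟨h2, h1⟩
      · obtain ⟨w, ⟨hw, hwc⟩, hu⟩ := h v (π b) (by rw [hv]; exact hbc)
        refine ⟨w, ⟨Or.inr hv, Or.inl hwc, hw⟩, ?_⟩
        rintro y ⟨-, h1 | h1, h2⟩
        · exact hu y ⟨h2, h1⟩
        · exact absurd (hv.trans h1.symm) (hne h2)
    · constructor
      · rw [Set.disjoint_left]
        intro v hv hv'
        exact hbc (((hblock _ _).1 hv).symm.trans ((hblock _ _).1 hv'))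
      · intro v w hvw
        simp only [SimpleGraph.Subgraph.spanningCoe_adj, SimpleGraph.Subgraph.induce_adj,
          SimpleGraph.Subgraph.top_adj, Set.mem_union, hblock] at hvw ⊢
        obtain ⟨h1 | h1, h2 | h2, h3⟩ := hvw
        · exact absurd (h1.trans h2.symm) (hne h3)
        · exact Or.inl ⟨h1, h2⟩
        · exact Or.inr ⟨h1, h2⟩
        · exact absurd (h1.trans h2.symm) (hne h3)

theorem hasValency_completeGraph_iff [Finite X] [Nonempty X] {k : ℕ} :
    HasValency (SimpleGraph.completeGraph X) k ↔ k + 1 = Nat.card X := by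
  have key : ∀ i : X, ((SimpleGraph.completeGraph X).neighborSet i).encard + 1 = Nat.card X := by
    intro i
    have : (SimpleGraph.completeGraph X).neighborSet i = Set.univ \ {i} := by
      ext j; simp [SimpleGraph.completeGraph, eq_comm]
    rw [this, Set.encard_sdiff_singleton_add_one (Set.mem_univ _), Set.encard_univ,
      ENat.card_eq_coe_natCard]
  constructor
  · intro h
    obtain ⟨i⟩ := ‹Nonempty X›
    have := key i
    rw [h i] at this
    exact_mod_cast this
  · intro h i
    have := key i
    rw [← h, Nat.cast_add, Nat.cast_one] at this
    exact ENat.add_left_injective_of_ne_top ENat.one_ne_top this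

theorem HasValency.of_iso {Γ : SimpleGraph V} {Δ : SimpleGraph W} (e : Γ ≃g Δ) {k : ℕ}
    (h : HasValency Γ k) : HasValency Δ k := by
  intro w
  obtain ⟨v, rfl⟩ := e.surjective w
  rw [← h v, ← e.injective.encard_image]
  congr 1
  ext x
  obtain ⟨y, rfl⟩ := e.surjective x
  simp [e.map_adj_iff]

theorem isPseudocoverOfQuotient_iff [Finite X] [Nonempty X] {Γ : SimpleGraph V} {r : Setoid V}
    (e : quotientGraph Γ r ≃g SimpleGraph.completeGraph X) :
    IsPseudocoverOfQuotient Γ r ↔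
      (∃ k, k + 1 = Nat.card X ∧ HasValency Γ k) ∧ ¬ IsCoverOfQuotient Γ r := by
  refine and_congr (exists_congr fun k => ?_) Iff.rfl
  rw [and_comm, ← hasValency_completeGraph_iff]
  exact and_congr ⟨fun h => h.of_iso e, fun h => h.of_iso e.symm⟩ Iff.rfl

/-- An arc-transitive group with a block system whose quotient is complete gives a
`BlockAction`. -/
theorem exists_blockAction {Γ : SimpleGraph V} {G : Subgroup (Γ ≃g Γ)} {r : Setoid V}
    (harc : IsArcTransitive Γ G) (hb : IsBlockSystem Γ G r)
    (e : quotientGraph Γ r ≃g SimpleGraph.completeGraph X) :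
    ∃ φ : G →* Perm X, BlockAction Γ φ (fun v => e (Quotient.mk r v)) ∧
      (IsFaithfulOnBlocks Γ G r → Function.Injective φ) := by
  let ψ : G →* Perm (Quotient r) :=
    { toFun := fun g => Quotient.congr g.1.toEquiv (fun a b => ⟨hb.invariant g.1 g.2 a b, fun h => by
        simpa using hb.invariant g.1⁻¹ (G.inv_mem g.2) _ _ h⟩)
      map_one' := by
        ext x; induction x using Quotient.inductionOn with | _ x => rfl
      map_mul' := fun g h => by
        ext x; induction x using Quotient.inductionOn with | _ x => rfl }
  have hmap : ∀ (g : G) (v : V), e (Quotient.mk r (g • v)) =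
      e.toEquiv.permCongrHom (ψ g) (e (Quotient.mk r v)) := by
    intro g v
    change _ = e (ψ g (e.symm (e (Quotient.mk r v))))
    rw [RelIso.symm_apply_apply]
    rfl
  refine ⟨e.toEquiv.permCongrHom.toMonoidHom.comp ψ, ?_, ?_⟩
  · refine ⟨fun g v w h => g.1.map_adj_iff.2 h, ?_, hmap, ?_, ?_⟩
    · intro a b c d hab hcd
      obtain ⟨g, hg, h1, h2⟩ := harc hab hcd
      exact ⟨⟨g, hg⟩, h1, h2⟩
    · intro hi
      apply hb.ne_bot
      ext v w
      simp only [Setoid.bot_def]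
      exact ⟨fun h => hi (congrArg e (Quotient.sound h)), fun h => h ▸ r.refl v⟩
    · intro i j hij
      have : (quotientGraph Γ r).Adj (e.symm i) (e.symm j) := by
        rw [e.symm.map_adj_iff]; exact hij
      obtain ⟨-, v, hv, w, hw, hvw⟩ := this
      refine ⟨v, w, hvw, ?_, ?_⟩
      · rw [show Quotient.mk r v = _ from hv, RelIso.apply_symm_apply]
      · rw [show Quotient.mk r w = _ from hw, RelIso.apply_symm_apply]
  · intro hf
    rw [injective_iff_map_eq_one]
    intro g hg
    apply Subtype.ext
    apply hf g.1 g.2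
    intro v
    have h1 := hmap g v
    have h2 : e.toEquiv.permCongrHom (ψ g) = 1 := hg
    rw [h2] at h1
    exact Quotient.exact (e.injective h1)

variable [Group A] [MulAction A V]

/-- A `BlockAction` through an injective homomorphism gives an arc-transitive group with a block
system whose quotient is complete. -/
theorem BlockAction.exists_isBlockSystem [Nontrivial X] {Γ : SimpleGraph V} {φ : A →* Perm X}
    {π : V → X} (h : BlockAction Γ φ π) (hφ : Function.Injective φ) :
    ∃ (G : Subgroup (Γ ≃g Γ)) (r : Setoid V), IsArcTransitive Γ G ∧ IsBlockSystem Γ G r ∧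
      IsFaithfulOnBlocks Γ G r ∧ Nonempty (quotientGraph Γ r ≃g SimpleGraph.completeGraph X) ∧
      (IsCoverOfQuotient Γ r ↔ UniqueLifting Γ π) := by
  let α : A →* (Γ ≃g Γ) :=
    { toFun := fun a => ⟨MulAction.toPerm a, adj_smul_iff h.adj_smul a⟩
      map_one' := by ext v; exact one_smul _ _
      map_mul' := fun a b => by ext v; exact mul_smul _ _ _ }
  let eq : Quotient (Setoid.ker π) ≃ X := Setoid.quotientKerEquivOfSurjective π h.surjective
  have heq : ∀ v, eq (Quotient.mk _ v) = π v := fun v => rfl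
  have hblock : ∀ v B, v ∈ block (Setoid.ker π) B ↔ π v = eq B := by
    intro v B
    rw [← heq, eq.apply_eq_iff_eq]
    rfl
  refine ⟨α.range, Setoid.ker π, ?_, ⟨?_, ?_, ?_⟩, ?_, ⟨eq, ?_⟩,
    isCoverOfQuotient_iff h.surjective (fun _ _ => Setoid.ker_def) h.map_ne h.exists_adj⟩
  · intro a b c d hab hcd
    obtain ⟨s, hs, hs'⟩ := h.arc_transitive hab hcd
    exact ⟨α s, ⟨s, rfl⟩, hs, hs'⟩
  · rintro _ ⟨s, rfl⟩ a b hab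
    change π (s • a) = π (s • b)
    rw [h.map_smul, h.map_smul, show π a = π b from hab]
  · intro hbot
    exact h.not_injective (Setoid.ker_eq_bot_iff.1 hbot)
  · intro htop
    obtain ⟨i, j, hij⟩ := exists_pair_ne X
    obtain ⟨v, w, -, rfl, rfl⟩ := h.exists_adj hij
    have : Setoid.ker π v w := by rw [htop]; trivial
    exact hij this
  · rintro _ ⟨s, rfl⟩ hs
    have : s = 1 := by
      apply hφ
      rw [map_one]
      ext i
      obtain ⟨v, rfl⟩ := h.surjective i
      rw [← h.map_smul]
      exact hs v
    rw [this, map_one]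
  · intro B C
    constructor
    · intro hBC
      have hBC : eq B ≠ eq C := hBC
      obtain ⟨v, w, hvw, hv, hw⟩ := h.exists_adj hBC
      exact ⟨fun e => hBC (congrArg eq e), v, (hblock _ _).2 hv, w, (hblock _ _).2 hw, hvw⟩
    · intro hBC
      exact eq.injective.ne hBC.1

end Quotients

/-! ### Transport along graph isomorphisms -/

section Transport

variable {V W A X : Type*} [Group A] [MulAction A W]

theorem BlockAction.congr {Γ : SimpleGraph V} {Δ : SimpleGraph W} (e : Γ ≃g Δ) {φ : A →* Perm X}
    {π : W → X} (h : BlockAction Δ φ π) :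
    letI := e.toEquiv.mulAction A
    BlockAction Γ φ (π ∘ e) := by
  let := e.toEquiv.mulAction A
  have hs : ∀ (a : A) (v : V), e (a • v) = a • e v := fun a v => e.apply_symm_apply _
  refine ⟨fun a v w hvw => ?_, fun {a b c d} hab hcd => ?_, fun a v => ?_, fun hi => ?_, fun hij => ?_⟩
  · rw [← e.map_adj_iff, hs, hs]
    exact h.adj_smul a (e.map_adj_iff.2 hvw)
  · obtain ⟨s, h1, h2⟩ := h.arc_transitive (e.map_adj_iff.2 hab) (e.map_adj_iff.2 hcd)
    exact ⟨s, e.injective (by rw [hs, h1]), e.injective (by rw [hs, h2])⟩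
  · rw [Function.comp_apply, hs, h.map_smul]; rfl
  · apply h.not_injective
    have := hi.comp e.symm.injective
    rwa [Function.comp_assoc, show (e ∘ e.symm : W → W) = id from funext e.apply_symm_apply] at this
  · obtain ⟨v, w, hvw, hv, hw⟩ := h.exists_adj hij
    exact ⟨e.symm v, e.symm w, e.symm.map_adj_iff.2 hvw, by simp [hv], by simp [hw]⟩

theorem UniqueLifting.congr {Γ : SimpleGraph V} {Δ : SimpleGraph W} (e : Γ ≃g Δ) {π : W → X} :
    UniqueLifting Γ (π ∘ e) ↔ UniqueLifting Δ π := by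
  constructor
  · intro h w j hj
    obtain ⟨y, ⟨hy, hyj⟩, hu⟩ := h (e.symm w) j (by simpa using hj)
    refine ⟨e y, ⟨by rw [← e.map_adj_iff] at hy; simpa using hy, hyj⟩, fun z hz => ?_⟩
    rw [← hu (e.symm z) ⟨e.symm.map_adj_iff.2 hz.1, by simpa using hz.2⟩]
    simp
  · intro h v j hj
    obtain ⟨y, ⟨hy, hyj⟩, hu⟩ := h (e v) j hj
    refine ⟨e.symm y, ⟨by rw [← e.map_adj_iff]; simpa using hy, by simpa using hyj⟩,
      fun z hz => ?_⟩
    rw [← hu (e z) ⟨e.map_adj_iff.2 hz.1, hz.2⟩]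
    simp

theorem isFaithfulArcTransitiveCover_of_iso [Nontrivial X] {Γ : SimpleGraph V} {Δ : SimpleGraph W}
    (e : Γ ≃g Δ) {φ : A →* Perm X} {π : W → X} (h : BlockAction Δ φ π)
    (hφ : Function.Injective φ) (hl : UniqueLifting Δ π) :
    IsFaithfulArcTransitiveCover Γ (SimpleGraph.completeGraph X) := by
  let := e.toEquiv.mulAction A
  obtain ⟨G, r, h1, h2, h3, h4, h5⟩ := (h.congr e).exists_isBlockSystem hφ
  exact ⟨G, r, h1, h2, h3, h4, h5.2 ((UniqueLifting.congr e).2 hl)⟩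

theorem isFaithfulArcTransitivePseudocover_of_iso [Nontrivial X] [Finite X] {Γ : SimpleGraph V}
    {Δ : SimpleGraph W} (e : Γ ≃g Δ) {φ : A →* Perm X} {π : W → X} (h : BlockAction Δ φ π)
    (hφ : Function.Injective φ) {k : ℕ} (hk : k + 1 = Nat.card X) (hΔ : HasValency Δ k)
    (hl : ¬ UniqueLifting Δ π) :
    IsFaithfulArcTransitivePseudocover Γ (SimpleGraph.completeGraph X) := by
  let := e.toEquiv.mulAction A
  obtain ⟨G, r, h1, h2, h3, ⟨h4⟩, h5⟩ := (h.congr e).exists_isBlockSystem hφ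
  refine ⟨G, r, h1, h2, h3, ⟨h4⟩, (isPseudocoverOfQuotient_iff h4).2
    ⟨⟨k, hk, hΔ.of_iso e.symm⟩, ?_⟩⟩
  rw [h5, UniqueLifting.congr e]
  exact hl

end Transport

/-! ### Coset graphs of the symmetric group -/

section CosetGraphs

variable {X : Type*} {x₀ x₁ : X} {L : Subgroup (Perm X)} {γ : Perm X}

/-- A proper subgroup `L` of the stabilizer of `x₀` and an involution `γ` that maps `x₀` to `x₁`
and generates the symmetric group together with `L`. -/
structure IsCosetPair (x₀ x₁ : X) (L : Subgroup (Perm X)) (γ : Perm X) : Prop where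
  mul_self : γ * γ = 1
  apply_base : γ x₀ = x₁
  ne : x₀ ≠ x₁
  apply_of_mem : ∀ p ∈ L, p x₀ = x₀
  exists_notMem : ∃ s : Perm X, s x₀ = x₀ ∧ s ∉ L
  eq_top : ∀ K : Subgroup (Perm X), L ≤ K → γ ∈ K → K = ⊤

/-- The graph on the cosets of `L` in which the neighbours of `p L` are the cosets in
`p L γ L`. -/
def cosetGraph (h : IsCosetPair x₀ x₁ L γ) : SimpleGraph (Perm X ⧸ L) where
  Adj a b := ∃ p : Perm X, (p : Perm X ⧸ L) = a ∧ ((p * γ : Perm X) : Perm X ⧸ L) = b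
  symm := ⟨fun a b ⟨p, hp, hq⟩ => ⟨p * γ, hq, by rw [mul_assoc, h.mul_self, mul_one, hp]⟩⟩
  loopless := ⟨fun a ⟨p, hp, hq⟩ => by
    rw [← hp, eq_comm, QuotientGroup.eq, inv_mul_cancel_left] at hq
    exact h.ne ((h.apply_of_mem _ hq).symm.trans h.apply_base)⟩

/-- The image of `x₀` under the elements of a coset of `L`. -/
def cosetProj (h : IsCosetPair x₀ x₁ L γ) (a : Perm X ⧸ L) : X :=
  Quotient.liftOn' a (fun p => p x₀) (fun p q hpq => by
    have := h.apply_of_mem _ (QuotientGroup.leftRel_apply.1 hpq)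
    rw [Perm.mul_apply, Perm.inv_eq_iff_eq] at this
    exact this.symm)

namespace IsCosetPair

theorem cosetProj_mk (h : IsCosetPair x₀ x₁ L γ) (p : Perm X) :
    cosetProj h (p : Perm X ⧸ L) = p x₀ := rfl

theorem cosetProj_smul (h : IsCosetPair x₀ x₁ L γ) (p : Perm X) (a : Perm X ⧸ L) :
    cosetProj h (p • a) = p (cosetProj h a) := by
  induction a using QuotientGroup.induction_on with | _ q => rfl

theorem smul_mk_one_eq_iff (p : Perm X) :
    p • ((1 : Perm X) : Perm X ⧸ L) = ((1 : Perm X) : Perm X ⧸ L) ↔ p ∈ L := by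
  rw [MulAction.Quotient.smul_coe, eq_comm, QuotientGroup.eq]
  simp

theorem locallyTransitive (h : IsCosetPair x₀ x₁ L γ) :
    LocallyTransitive (cosetGraph h) (Perm X) ((1 : Perm X) : Perm X ⧸ L) γ where
  adj_smul := by
    rintro s a b ⟨p, rfl, rfl⟩
    exact ⟨s * p, rfl, by rw [mul_assoc]; rfl⟩
  adj_base := ⟨1, rfl, by rw [MulAction.Quotient.smul_coe]; simp⟩
  exists_of_adj := by
    rintro w ⟨p, hp, rfl⟩
    refine ⟨p, ?_, ?_⟩
    · rw [MulAction.Quotient.smul_coe]; simpa using hp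
    · rw [MulAction.Quotient.smul_coe, MulAction.Quotient.smul_coe]; simp

theorem adj_mk_one_iff (h : IsCosetPair x₀ x₁ L γ) (a : Perm X ⧸ L) :
    (cosetGraph h).Adj ((1 : Perm X) : Perm X ⧸ L) a ↔
      ∃ p ∈ L, ((p * γ : Perm X) : Perm X ⧸ L) = a := by
  constructor
  · rintro ⟨p, hp, rfl⟩
    rw [eq_comm, QuotientGroup.eq] at hp
    exact ⟨p, by simpa using hp, rfl⟩
  · rintro ⟨p, hp, rfl⟩
    exact ⟨p, by rw [eq_comm, QuotientGroup.eq]; simpa using hp, rfl⟩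

theorem connected (h : IsCosetPair x₀ x₁ L γ) : (cosetGraph h).Connected := by
  let v₀ : Perm X ⧸ L := ((1 : Perm X) : Perm X ⧸ L)
  have hadj := h.locallyTransitive.adj_smul
  have hreach : ∀ (p : Perm X) {a b}, (cosetGraph h).Reachable a b →
      (cosetGraph h).Reachable (p • a) (p • b) := by
    rintro p a b ⟨w⟩
    exact ⟨w.map ⟨(p • ·), fun hab => hadj p hab⟩⟩
  -- The permutations that keep `v₀` in its connected component form a subgroup containing `L` and
  -- `γ`, hence everything.
  let K : Subgroup (Perm X) :=
    { carrier := {p | (cosetGraph h).Reachable v₀ (p • v₀)}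
      one_mem' := by
        simp only [Set.mem_ofPred_eq, one_smul]
        exact SimpleGraph.Reachable.refl _
      mul_mem' := fun {p q} hp hq => by
        simp only [Set.mem_ofPred_eq, mul_smul] at hp hq ⊢
        exact hp.trans (hreach p hq)
      inv_mem' := fun {p} hp => by
        simp only [Set.mem_ofPred_eq] at hp ⊢
        have := hreach p⁻¹ hp
        rw [inv_smul_smul] at this
        exact this.symm }
  have hK : K = ⊤ := by
    apply h.eq_top
    · intro p hp
      change (cosetGraph h).Reachable v₀ (p • v₀)
      rw [(smul_mk_one_eq_iff p).2 hp]
    · exact h.locallyTransitive.adj_base.reachable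
  have hall : ∀ a, (cosetGraph h).Reachable v₀ a := by
    intro a
    induction a using QuotientGroup.induction_on with | _ p =>
    have : p ∈ K := hK ▸ Subgroup.mem_top p
    have : (cosetGraph h).Reachable v₀ (p • v₀) := this
    rwa [MulAction.Quotient.smul_coe, smul_eq_mul, mul_one] at this
  exact ⟨fun a b => (hall a).symm.trans (hall b)⟩

theorem blockAction [DecidableEq X] (h : IsCosetPair x₀ x₁ L γ) :
    BlockAction (cosetGraph h) (MonoidHom.id (Perm X)) (cosetProj h) where
  adj_smul := h.locallyTransitive.adj_smul
  arc_transitive := h.locallyTransitive.arc_transitive h.connected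
  map_smul := h.cosetProj_smul
  not_injective hi := by
    obtain ⟨s, hs, hsL⟩ := h.exists_notMem
    have : (s : Perm X ⧸ L) = (1 : Perm X) := hi (by rw [cosetProj_mk, cosetProj_mk, hs]; rfl)
    rw [eq_comm, QuotientGroup.eq] at this
    exact hsL (by simpa using this)
  exists_adj {i j} hij := by
    -- This `p` sends `x₀` to `i` and `x₁ = γ x₀` to `j`.
    let p := swap (swap x₀ i x₁) j * swap x₀ i
    refine ⟨(p : Perm X ⧸ L), ((p * γ : Perm X) : Perm X ⧸ L), ⟨p, rfl, rfl⟩, ?_, ?_⟩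
    · have h1 : i ≠ swap x₀ i x₁ := by
        intro e
        have : swap x₀ i x₀ = swap x₀ i x₁ := by rw [← e, swap_apply_left]
        exact h.ne ((swap x₀ i).injective this)
      rw [cosetProj_mk, Perm.mul_apply, swap_apply_left, swap_apply_of_ne_of_ne h1 hij]
    · rw [cosetProj_mk, Perm.mul_apply, h.apply_base, Perm.mul_apply, swap_apply_left]

end IsCosetPair

/-- A coset pair whose coset graph covers the complete graph. -/
structure IsCoverPair (x₀ x₁ : X) (L : Subgroup (Perm X)) (γ : Perm X) : Prop
    extends IsCosetPair x₀ x₁ L γ where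
  exists_apply_eq : ∀ j, j ≠ x₀ → ∃ p ∈ L, p x₁ = j
  conj_mem : ∀ p ∈ L, p x₁ = x₁ → γ⁻¹ * p * γ ∈ L

/-- Transitivity of `L` away from `x₀` yields a neighbour in each other part. Two elements of `L`
that agree at `x₁` give the same coset of `L` after multiplication by `γ`; this is `conj_mem`, and
it gives uniqueness. -/
theorem IsCoverPair.uniqueLifting (h : IsCoverPair x₀ x₁ L γ) :
    UniqueLifting (cosetGraph h.toIsCosetPair) (cosetProj h.toIsCosetPair) := by
  intro a j hj
  induction a using QuotientGroup.induction_on with | _ s =>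
  have hadj : ∀ b, (cosetGraph h.toIsCosetPair).Adj (s : Perm X ⧸ L) b ↔
      ∃ p ∈ L, ((s * p * γ : Perm X) : Perm X ⧸ L) = b := by
    intro b
    rw [← adj_smul_iff h.locallyTransitive.adj_smul s⁻¹, MulAction.Quotient.smul_coe, smul_eq_mul,
      inv_mul_cancel, h.adj_mk_one_iff]
    refine exists_congr fun p => and_congr_right fun _ => ?_
    rw [eq_inv_smul_iff, MulAction.Quotient.smul_coe, smul_eq_mul, mul_assoc]
  have hj' : s⁻¹ j ≠ x₀ := by
    rw [Ne, Perm.inv_eq_iff_eq]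
    exact hj
  obtain ⟨p, hp, hpj⟩ := h.exists_apply_eq _ hj'
  refine ⟨_, ⟨(hadj _).2 ⟨p, hp, rfl⟩, ?_⟩, ?_⟩
  · change s (p (γ x₀)) = j
    rw [h.apply_base, hpj]; simp
  · rintro b ⟨hb, hbj⟩
    obtain ⟨q, hq, rfl⟩ := (hadj _).1 hb
    have hbj : s (q (γ x₀)) = j := hbj
    rw [h.apply_base] at hbj
    rw [QuotientGroup.eq]
    have := h.conj_mem (q⁻¹ * p) (L.mul_mem (L.inv_mem hq) hp)
      (by rw [Perm.mul_apply, hpj, Perm.inv_eq_iff_eq, ← hbj]; simp)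
    convert this using 1
    group

end CosetGraphs

/-! ### Vertex stabilizers of covers -/

section Setups

variable {V A X : Type*} [Group A] [MulAction A V]

/-- A connected cover of a complete graph with a faithful arc-transitive group, together with an
element `g` that moves a vertex `v₀` over `x₀` to a neighbour over `x₁`. -/
structure CoverSetup (x₀ x₁ : X) (Γ : SimpleGraph V) (φ : A →* Perm X) (π : V → X) (v₀ : V)
    (g : A) : Prop where
  connected : Γ.Connected
  blockAction : BlockAction Γ φ π
  injective : Function.Injective φ
  uniqueLifting : UniqueLifting Γ π
  map_base : π v₀ = x₀
  apply_base : φ g x₀ = x₁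
  adj_base : Γ.Adj v₀ (g • v₀)

/-- The image in the symmetric group of the stabilizer of `v₀`. -/
def fixer (φ : A →* Perm X) (v₀ : V) : Subgroup (Perm X) := (MulAction.stabilizer A v₀).map φ

theorem apply_mem_fixer_iff {φ : A →* Perm X} (hφ : Function.Injective φ) {v₀ : V} {a : A} :
    φ a ∈ fixer φ v₀ ↔ a • v₀ = v₀ :=
  Subgroup.mem_map_iff_mem hφ

theorem BlockAction.apply_of_mem_fixer {Γ : SimpleGraph V} {φ : A →* Perm X} {π : V → X}
    (h : BlockAction Γ φ π) {v₀ : V} {p : Perm X} (hp : p ∈ fixer φ v₀) : p (π v₀) = π v₀ := by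
  obtain ⟨a, ha, rfl⟩ := hp
  rw [← h.map_smul, show a • v₀ = v₀ from ha]

namespace CoverSetup

variable {x₀ x₁ : X} {Γ : SimpleGraph V} {φ : A →* Perm X} {π : V → X} {v₀ : V} {g : A}

theorem relabel (h : CoverSetup x₀ x₁ Γ φ π v₀ g) {τ : Perm X} (h₀ : τ x₀ = x₀) (h₁ : τ x₁ = x₁) :
    CoverSetup x₀ x₁ Γ ((MulAut.conj τ).toMonoidHom.comp φ) (τ ∘ π) v₀ g where
  connected := h.connected
  blockAction := h.blockAction.relabel τ
  injective := (MulAut.conj τ).injective.comp h.injective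
  uniqueLifting := h.uniqueLifting.relabel τ
  map_base := by simp [h.map_base, h₀]
  apply_base := by
    change τ (φ g (τ⁻¹ x₀)) = x₁
    rw [Perm.inv_eq_iff_eq.2 h₀.symm, h.apply_base, h₁]
  adj_base := h.adj_base

theorem mem_fixer_relabel (τ : Perm X) {p : Perm X} (hp : p ∈ fixer φ v₀) :
    τ * p * τ⁻¹ ∈ fixer ((MulAut.conj τ).toMonoidHom.comp φ) v₀ := by
  obtain ⟨a, ha, rfl⟩ := hp
  exact ⟨a, ha, rfl⟩

theorem map_smul_base (h : CoverSetup x₀ x₁ Γ φ π v₀ g) : π (g • v₀) = x₁ := by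
  rw [h.blockAction.map_smul, h.map_base, h.apply_base]

theorem apply_of_mem (h : CoverSetup x₀ x₁ Γ φ π v₀ g) {p : Perm X} (hp : p ∈ fixer φ v₀) :
    p x₀ = x₀ := by
  have := h.blockAction.apply_of_mem_fixer hp
  rwa [h.map_base] at this

theorem exists_mem_fixer (h : CoverSetup x₀ x₁ Γ φ π v₀ g) {j : X} (hj : j ≠ x₀) :
    ∃ p ∈ fixer φ v₀, p x₁ = j := by
  obtain ⟨w, ⟨hw, rfl⟩, -⟩ := h.uniqueLifting v₀ j (by rw [h.map_base]; exact hj)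
  obtain ⟨s, hs, rfl⟩ := h.blockAction.arc_transitive h.adj_base hw
  exact ⟨φ s, ⟨s, hs, rfl⟩, by rw [h.blockAction.map_smul, h.map_smul_base]⟩

/-- A neighbour of `v₀` is determined by its part, so only the value of `φ a` at `x₁` matters. -/
theorem smul_eq_of_adj (h : CoverSetup x₀ x₁ Γ φ π v₀ g) {a : A} (ha : a • v₀ = v₀) {w : V}
    (hw : Γ.Adj v₀ w) (haw : φ a x₁ = π w) (hne : π w ≠ x₀) : a • g • v₀ = w := by
  refine (h.uniqueLifting v₀ (π w) (by rw [h.map_base]; exact hne)).unique ⟨?_, ?_⟩ ⟨hw, rfl⟩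
  · have := h.blockAction.adj_smul a h.adj_base
    rwa [ha] at this
  · rw [h.blockAction.map_smul, h.map_smul_base, haw]

theorem exists_comap_of_adj [Nontrivial X] (h : CoverSetup x₀ x₁ Γ φ π v₀ g)
    {S : Subgroup (Perm X)} (hS : ∀ j, j ≠ x₀ → ∃ p ∈ S, p ∈ fixer φ v₀ ∧ p x₁ = j) {w : V}
    (hw : Γ.Adj v₀ w) : ∃ a ∈ S.comap φ, a • v₀ = v₀ ∧ a • g • v₀ = w := by
  have hne : π w ≠ x₀ := by
    rw [← h.map_base]
    exact (h.blockAction.map_ne hw).symm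
  obtain ⟨_, hp, ⟨a, ha, rfl⟩, hpw⟩ := hS (π w) hne
  exact ⟨a, hp, ha, h.smul_eq_of_adj ha hw hpw hne⟩

/-- A subgroup with which one reaches all neighbours cannot contain a full vertex stabilizer. -/
theorem not_forall_mem_fixer [Nontrivial X] (h : CoverSetup x₀ x₁ Γ φ π v₀ g)
    {S : Subgroup (Perm X)} (hg : φ g ∈ S)
    (hS : ∀ j, j ≠ x₀ → ∃ p ∈ S, p ∈ fixer φ v₀ ∧ p x₁ = j) :
    ¬ ∀ p ∈ S, p x₀ = x₀ → p ∈ fixer φ v₀ := by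
  intro hall
  -- `S` is transitive on vertices, and its elements fixing `x₀` fix `v₀`. Two vertices in one part
  -- would therefore coincide.
  apply h.blockAction.not_injective
  have htrans := exists_mem_smul_eq h.connected h.blockAction.adj_smul v₀ (S.comap φ)
    (fun w hw => by
      obtain ⟨a, haS, -, ha⟩ := h.exists_comap_of_adj hS hw
      exact ⟨a * g, (S.comap φ).mul_mem haS hg, by rw [mul_smul, ha]⟩)
  intro v w hvw
  obtain ⟨a, haS, rfl⟩ := htrans v
  obtain ⟨b, hbS, rfl⟩ := htrans w
  rw [h.blockAction.map_smul, h.blockAction.map_smul, h.map_base] at hvw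
  have hmem : φ (b⁻¹ * a) ∈ fixer φ v₀ := by
    apply hall
    · exact (S.comap φ).mul_mem ((S.comap φ).inv_mem hbS) haS
    · rw [map_mul, map_inv, Perm.mul_apply, Perm.inv_eq_iff_eq, hvw]
  rw [apply_mem_fixer_iff h.injective, mul_smul, inv_smul_eq_iff] at hmem
  exact hmem

/-- The stabilizer has to agree with `L` only inside `S`. With `S` the alternating group, a graph of
`A₅` is recognised as a coset graph of `S₅`. -/
theorem nonempty_iso [Nontrivial X] (h : CoverSetup x₀ x₁ Γ φ π v₀ g) {L S : Subgroup (Perm X)}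
    {γ : Perm X} (hp : IsCoverPair x₀ x₁ L γ) (hS : ∀ p ∈ S, p ∈ fixer φ v₀ ↔ p ∈ L)
    (hg : φ g ∈ S) (hγ : γ⁻¹ * φ g ∈ L) (hloc : ∀ j, j ≠ x₀ → ∃ p ∈ S, p ∈ L ∧ p x₁ = j) :
    Nonempty (Γ ≃g cosetGraph hp.toIsCosetPair) := by
  have hloc' : ∀ j, j ≠ x₀ → ∃ p ∈ S, p ∈ fixer φ v₀ ∧ p x₁ = j := fun j hj => by
    obtain ⟨p, hpS, hpL, hpj⟩ := hloc j hj
    exact ⟨p, hpS, (hS p hpS).2 hpL, hpj⟩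
  have hT : LocallyTransitive Γ (S.comap φ) v₀ ⟨g, hg⟩ :=
    ⟨fun a v w hvw => h.blockAction.adj_smul a.1 hvw, h.adj_base, fun hw => by
      obtain ⟨a, haS, ha, haw⟩ := h.exists_comap_of_adj hloc' hw
      exact ⟨⟨a, haS⟩, ha, haw⟩⟩
  refine hT.nonempty_iso h.connected hp.locallyTransitive hp.connected
    (φ.comp (S.comap φ).subtype) ?_ ?_ ?_
  · intro a
    rw [IsCosetPair.smul_mk_one_eq_iff]
    exact (apply_mem_fixer_iff h.injective).symm.trans (hS _ a.2)
  · change φ g • _ = _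
    rw [MulAction.Quotient.smul_coe, MulAction.Quotient.smul_coe, eq_comm, QuotientGroup.eq]
    simpa using hγ
  · intro p hpL
    rw [IsCosetPair.smul_mk_one_eq_iff] at hpL
    have hne : p x₁ ≠ x₀ := by
      rw [← hp.apply_of_mem p hpL]
      exact p.injective.ne hp.ne.symm
    obtain ⟨q, hqS, hqL, hqj⟩ := hloc _ hne
    obtain ⟨a, ha, rfl⟩ := (hS q hqS).2 hqL
    refine ⟨⟨a, hqS⟩, ha, ?_⟩
    change φ a • _ = _
    rw [MulAction.Quotient.smul_coe, MulAction.Quotient.smul_coe, MulAction.Quotient.smul_coe,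
      QuotientGroup.eq]
    have := hp.conj_mem ((φ a)⁻¹ * p) (L.mul_mem (L.inv_mem hqL) hpL)
      (by rw [Perm.mul_apply, Perm.inv_eq_iff_eq, hqj])
    convert this using 1
    simp [mul_assoc]

end CoverSetup

/-- A faithful arc-transitive cover of a complete graph has a `CoverSetup` over any two distinct
points, whose group element acts as the cube of a permutation that swaps them. -/
theorem exists_coverSetup {V : Type*} [Nontrivial X] {Γ : SimpleGraph V} (hc : Γ.Connected)
    (h : IsFaithfulArcTransitiveCover Γ (SimpleGraph.completeGraph X)) {x₀ x₁ : X} (hx : x₀ ≠ x₁) :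
    ∃ (G : Subgroup (Γ ≃g Γ)) (φ : G →* Perm X) (π : V → X) (v₀ : V) (g : G),
      CoverSetup x₀ x₁ Γ φ π v₀ g ∧ ∃ q : Perm X, q x₀ = x₁ ∧ q x₁ = x₀ ∧ φ g = q ^ 3 := by
  obtain ⟨G, r, harc, hb, hf, ⟨e⟩, hcov⟩ := h
  obtain ⟨φ, hφ, hinj⟩ := exists_blockAction harc hb e
  obtain ⟨v, w, hvw, hv, hw⟩ := hφ.exists_adj hx
  obtain ⟨g, hg, hg'⟩ := hφ.arc_transitive hvw hvw.symm
  have h1 := hφ.map_smul g v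
  have h2 := hφ.map_smul g w
  simp only [hg, hg', hv, hw] at h1 h2
  -- An odd power of `g` still swaps `v` and `w`; the cube removes a possible 3-cycle on the
  -- remaining points.
  have h3 : (g ^ 3) • v = w := by
    rw [pow_succ, mul_smul, pow_two, mul_smul, hg, hg', hg]
  refine ⟨G, φ, _, v, g ^ 3, ⟨hc, hφ, hinj hf, ?_, hv, ?_, by rwa [h3]⟩,
    φ g, h1.symm, h2.symm, map_pow _ _ _⟩
  swap
  · rw [← hv, ← hφ.map_smul, h3, hw]
  exact (isCoverOfQuotient_iff hφ.surjective
    (fun v w => (e.injective.eq_iff.trans Quotient.eq).symm) hφ.map_ne hφ.exists_adj).1 hcov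

end Setups

/-! ### Generation and subgroups fixing a point -/

section Generation

variable {X : Type*}

/-- Conjugates of `swap x₀ x₁` give every `swap x₀ j`, and these generate all transpositions. -/
theorem eq_top_of_swap_mem [DecidableEq X] [Finite X] {K : Subgroup (Perm X)} {x₀ x₁ : X}
    (hx : x₀ ≠ x₁) (hs : swap x₀ x₁ ∈ K)
    (hK : ∀ j, j ≠ x₀ → ∃ p ∈ K, p x₀ = x₀ ∧ p x₁ = j) : K = ⊤ := by
  have h0 : ∀ j, j ≠ x₀ → swap x₀ j ∈ K := by
    intro j hj
    obtain ⟨p, hp, h0, h1⟩ := hK j hj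
    have := K.mul_mem (K.mul_mem hp hs) (K.inv_mem hp)
    rwa [← swap_apply_apply, h0, h1] at this
  rw [eq_top_iff, ← Perm.closure_isSwap, Subgroup.closure_le]
  rintro _ ⟨i, j, hij, rfl⟩
  by_cases hi : i = x₀
  · subst hi; exact h0 j hij.symm
  by_cases hj : j = x₀
  · subst hj; rw [swap_comm]; exact h0 i hi
  have := K.mul_mem (K.mul_mem (h0 i hi) (h0 j hj)) (K.inv_mem (h0 i hi))
  rwa [← swap_apply_apply, swap_apply_left, swap_apply_of_ne_of_ne hj (Ne.symm hij)] at this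

/-- The permutations that fix `x₀` and commute with `s`. -/
def pointedCentralizer (x₀ : X) (s : Perm X) : Subgroup (Perm X) :=
  MulAction.stabilizer (Perm X) x₀ ⊓ Subgroup.centralizer {s}

theorem mem_pointedCentralizer {x₀ : X} {s p : Perm X} :
    p ∈ pointedCentralizer x₀ s ↔ p x₀ = x₀ ∧ p * s = s * p := by
  rw [pointedCentralizer, Subgroup.mem_inf, MulAction.mem_stabilizer_iff,
    Subgroup.mem_centralizer_singleton_iff]
  rfl

/-- The even permutations that fix `x₀`. -/
def pointedAlternating [DecidableEq X] [Fintype X] (x₀ : X) : Subgroup (Perm X) :=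
  MulAction.stabilizer (Perm X) x₀ ⊓ alternatingGroup X

theorem mem_pointedAlternating [DecidableEq X] [Fintype X] {x₀ : X} {p : Perm X} :
    p ∈ pointedAlternating x₀ ↔ p x₀ = x₀ ∧ Perm.sign p = 1 := by
  rw [pointedAlternating, Subgroup.mem_inf, MulAction.mem_stabilizer_iff,
    Perm.mem_alternatingGroup]
  rfl

end Generation

/-- A 4-cycle on `Fin 5` that fixes `0`. -/
abbrev fourCycle : Perm (Fin 5) := swap 1 2 * swap 2 4 * swap 4 3

/-- The affine permutations of `Fin 5`. -/
def affineGroup : Subgroup (Perm (Fin 5)) where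
  carrier := {p | ∀ x y, p (x + y) + p 0 = p x + p y}
  one_mem' x y := by simp
  mul_mem' {p q} hp hq x y := by
    have hq' : ∀ x y z w, x + y = z + w → q x + q y = q z + q w := fun x y z w e => by
      rw [← hq x y, e, hq z w]
    have hp' : ∀ x y z w, x + y = z + w → p x + p y = p z + p w := fun x y z w e => by
      rw [← hp x y, e, hp z w]
    exact hp' _ _ _ _ (hq' _ _ _ _ (add_zero _))
  inv_mem' {p} hp x y := by
    have key : ∀ a b c d, p a + p b = p c + p d → a + b = c + d := by
      intro a b c d h
      have : p (a + b) = p (c + d) := by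
        have h1 := hp a b
        rw [h, ← hp c d] at h1
        exact add_right_cancel h1
      exact p.injective this
    apply key
    simp

theorem mem_affineGroup {p : Perm (Fin 5)} :
    p ∈ affineGroup ↔ ∀ x y, p (x + y) + p 0 = p x + p y := Iff.rfl

/-! ### The five cover pairs in `S₅` -/

section Pairs

theorem isCoverPair_alternating :
    IsCoverPair (0 : Fin 5) 1 (pointedAlternating 0) (swap 0 1) where
  mul_self := by decide
  apply_base := by decide
  ne := by decide
  apply_of_mem p hp := (mem_pointedAlternating.1 hp).1
  exists_notMem := ⟨swap 1 2, by decide, by rw [mem_pointedAlternating]; decide⟩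
  eq_top K hL hγ := eq_top_of_swap_mem (by decide) hγ fun j hj => by
    have : ∀ j : Fin 5, j ≠ 0 → ∃ p : Perm (Fin 5), (p 0 = 0 ∧ Perm.sign p = 1) ∧ p 1 = j := by
      decide +kernel
    obtain ⟨p, hp, hpj⟩ := this j hj
    exact ⟨p, hL (mem_pointedAlternating.2 hp), hp.1, hpj⟩
  exists_apply_eq := by
    simp only [mem_pointedAlternating]
    decide +kernel
  conj_mem := by
    simp only [mem_pointedAlternating]
    decide +kernel

theorem isCoverPair_dihedral :
    IsCoverPair (0 : Fin 5) 1 (pointedCentralizer 0 (fourCycle ^ 2)) (swap 0 1) where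
  mul_self := by decide
  apply_base := by decide
  ne := by decide
  apply_of_mem p hp := (mem_pointedCentralizer.1 hp).1
  exists_notMem := ⟨swap 1 2, by decide, by rw [mem_pointedCentralizer]; decide⟩
  eq_top K hL hγ := eq_top_of_swap_mem (by decide) hγ fun j hj => by
    have : ∀ j : Fin 5, j ≠ 0 → ∃ p : Perm (Fin 5),
        (p 0 = 0 ∧ p * fourCycle ^ 2 = fourCycle ^ 2 * p) ∧ p 1 = j := by
      decide +kernel
    obtain ⟨p, hp, hpj⟩ := this j hj
    exact ⟨p, hL (mem_pointedCentralizer.2 hp), hp.1, hpj⟩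
  exists_apply_eq := by
    simp only [mem_pointedCentralizer]
    decide +kernel
  conj_mem := by
    simp only [mem_pointedCentralizer]
    decide +kernel

/-- The Klein four-group of double transpositions that fix `0`. -/
def kleinGroup : Subgroup (Perm (Fin 5)) :=
  pointedCentralizer 0 (swap 1 2 * swap 3 4) ⊓ pointedCentralizer 0 (swap 1 3 * swap 2 4)

theorem mem_kleinGroup {p : Perm (Fin 5)} : p ∈ kleinGroup ↔
    p ∈ [1, swap 1 2 * swap 3 4, swap 1 3 * swap 2 4, swap 1 4 * swap 2 3] := by
  rw [kleinGroup, Subgroup.mem_inf, mem_pointedCentralizer, mem_pointedCentralizer]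
  revert p
  decide +kernel

theorem isCoverPair_klein : IsCoverPair (0 : Fin 5) 1 kleinGroup (swap 0 1) where
  mul_self := by decide
  apply_base := by decide
  ne := by decide
  apply_of_mem p hp := (mem_pointedCentralizer.1 hp.1).1
  exists_notMem := ⟨swap 1 2, by decide, by rw [mem_kleinGroup]; decide⟩
  eq_top K hL hγ := eq_top_of_swap_mem (by decide) hγ fun j hj => by
    have : ∀ j : Fin 5, j ≠ 0 → ∃ p : Perm (Fin 5),
        p ∈ [1, swap 1 2 * swap 3 4, swap 1 3 * swap 2 4, swap 1 4 * swap 2 3] ∧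
          p 0 = 0 ∧ p 1 = j := by
      decide +kernel
    obtain ⟨p, hp, hpj⟩ := this j hj
    exact ⟨p, hL (mem_kleinGroup.2 hp), hpj⟩
  exists_apply_eq := by
    simp only [mem_kleinGroup]
    decide +kernel
  conj_mem := by
    simp only [mem_kleinGroup]
    decide +kernel

theorem fourCycle_mem : fourCycle ∈ pointedCentralizer 0 fourCycle := by
  rw [mem_pointedCentralizer]; decide

theorem mem_pointedCentralizer_fourCycle {p : Perm (Fin 5)} :
    p ∈ pointedCentralizer 0 fourCycle ↔ ∃ k : Fin 4, p = fourCycle ^ (k : ℕ) := by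
  rw [mem_pointedCentralizer]
  revert p
  decide +kernel

theorem exists_fourCycle_pow {K : Subgroup (Perm (Fin 5))} (hK : fourCycle ∈ K) :
    ∀ j, j ≠ 0 → ∃ p ∈ K, p 0 = 0 ∧ p 1 = j := by
  have : ∀ j : Fin 5, j ≠ 0 → ∃ k : Fin 4,
      (fourCycle ^ (k : ℕ)) 0 = 0 ∧ (fourCycle ^ (k : ℕ)) 1 = j := by
    decide +kernel
  intro j hj
  obtain ⟨k, hk⟩ := this j hj
  exact ⟨_, K.pow_mem hK _, hk⟩

/-- The cyclic group is regular on the nonzero points, so `conj_mem` concerns only the identity.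
Only generation depends on `γ`. -/
theorem isCoverPair_cyclic {γ : Perm (Fin 5)} (h2 : γ * γ = 1) (h01 : γ 0 = 1)
    (hγ : ∀ K : Subgroup (Perm (Fin 5)), fourCycle ∈ K → γ ∈ K → swap 0 1 ∈ K) :
    IsCoverPair (0 : Fin 5) 1 (pointedCentralizer 0 fourCycle) γ where
  mul_self := h2
  apply_base := h01
  ne := by decide
  apply_of_mem p hp := (mem_pointedCentralizer.1 hp).1
  exists_notMem := ⟨swap 1 2, by decide, by rw [mem_pointedCentralizer]; decide⟩
  eq_top K hL hK := eq_top_of_swap_mem (by decide) (hγ K (hL fourCycle_mem) hK)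
    (exists_fourCycle_pow (hL fourCycle_mem))
  exists_apply_eq j hj := by
    obtain ⟨p, hp, -, h⟩ := exists_fourCycle_pow fourCycle_mem j hj
    exact ⟨p, hp, h⟩
  conj_mem p hp h1 := by
    have : p = 1 := by
      rw [mem_pointedCentralizer] at hp
      revert p
      decide +kernel
    simp [this]

theorem isCoverPair_cyclic_swap :
    IsCoverPair (0 : Fin 5) 1 (pointedCentralizer 0 fourCycle) (swap 0 1) :=
  isCoverPair_cyclic (by decide) (by decide) (fun _ _ h => h)

theorem isCoverPair_cyclic_swap_mul_swap :
    IsCoverPair (0 : Fin 5) 1 (pointedCentralizer 0 fourCycle) (swap 0 1 * swap 2 3) := by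
  refine isCoverPair_cyclic (by decide) (by decide) (fun K hc hg => ?_)
  have hx := K.mul_mem (K.inv_mem hc) (K.mul_mem hg hc)
  -- With `c = fourCycle`, `g` the double transposition and `x = c⁻¹ g c`, the word `x g x g c⁻¹`
  -- equals `swap 0 1`.
  have := K.mul_mem (K.mul_mem (K.mul_mem hx hg) hx) (K.mul_mem hg (K.inv_mem hc))
  convert this using 1
  decide +kernel

end Pairs

/-! ### Classification of the covers of `K₅` -/

section Classification

variable {V A : Type*} [Group A] [MulAction A V] {Γ : SimpleGraph V} {φ : A →* Perm (Fin 5)}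
  {π : V → Fin 5} {v₀ : V} {g : A}

/-- The five covers of the complete graph on five vertices. -/
def IsListedCover (Γ : SimpleGraph V) : Prop :=
  Nonempty (Γ ≃g cosetGraph isCoverPair_alternating.toIsCosetPair) ∨
  Nonempty (Γ ≃g cosetGraph isCoverPair_dihedral.toIsCosetPair) ∨
  Nonempty (Γ ≃g cosetGraph isCoverPair_klein.toIsCosetPair) ∨
  Nonempty (Γ ≃g cosetGraph isCoverPair_cyclic_swap.toIsCosetPair) ∨
  Nonempty (Γ ≃g cosetGraph isCoverPair_cyclic_swap_mul_swap.toIsCosetPair)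

/-- On `{2, 3, 4}` such a `q` has order 1, 2 or 3, so its cube is there trivial or a transposition.
-/
theorem cube_of_swapping : ∀ q : Perm (Fin 5), q 0 = 1 → q 1 = 0 →
    q ^ 3 = swap 0 1 ∨ q ^ 3 = swap 0 1 * swap 2 3 ∨ q ^ 3 = swap 0 1 * swap 2 4 ∨
      q ^ 3 = swap 0 1 * swap 3 4 := by
  decide +kernel

theorem kleinGroup_le {H : Subgroup (Perm (Fin 5))} (h1 : swap 1 2 * swap 3 4 ∈ H)
    (h2 : swap 1 4 * swap 2 3 ∈ H) : kleinGroup ≤ H := by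
  intro p hp
  rw [mem_kleinGroup] at hp
  simp only [List.mem_cons, List.not_mem_nil, or_false] at hp
  rcases hp with rfl | rfl | rfl | rfl
  · exact H.one_mem
  · exact h1
  · rw [show (swap 1 3 * swap 2 4 : Perm (Fin 5)) =
      swap 1 2 * swap 3 4 * (swap 1 4 * swap 2 3) by decide]
    exact H.mul_mem h1 h2
  · exact h2

/-- `V₄` has index 3 in `A₄`, so any further even element generates the quotient. -/
theorem pointedAlternating_le {H : Subgroup (Perm (Fin 5))} (hV : kleinGroup ≤ H)
    {p : Perm (Fin 5)} (hp : p ∈ H) (hpa : p ∈ pointedAlternating 0) (hpV : p ∉ kleinGroup) :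
    pointedAlternating 0 ≤ H := by
  have : ∀ p : Perm (Fin 5), (p 0 = 0 ∧ Perm.sign p = 1) ∧
      p ∉ [1, swap 1 2 * swap 3 4, swap 1 3 * swap 2 4, swap 1 4 * swap 2 3] →
      ∀ q : Perm (Fin 5), q 0 = 0 ∧ Perm.sign q = 1 →
      ∃ k : Fin 3, q * p ^ (k : ℕ) ∈
        [1, swap 1 2 * swap 3 4, swap 1 3 * swap 2 4, swap 1 4 * swap 2 3] := by
    decide +kernel
  intro q hq
  rw [mem_pointedAlternating] at hpa hq
  rw [mem_kleinGroup] at hpV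
  obtain ⟨k, hk⟩ := this p ⟨hpa, hpV⟩ q hq
  exact (H.mul_mem_cancel_right (H.pow_mem hp k)).1 (hV (mem_kleinGroup.2 hk))

theorem kleinGroup_le_alternatingGroup : kleinGroup ≤ alternatingGroup (Fin 5) := by
  intro p hp
  rw [Perm.mem_alternatingGroup]
  rw [mem_kleinGroup] at hp
  revert p
  decide +kernel

namespace CoverSetup

/-- Here `φ g` is even, so everything can be tested inside `A₅`. If the even part of the fixer
exceeded `V₄`, it would be `A₄`, the full point stabilizer in `A₅`, which is impossible. So it is
`V₄`, which is also the even part of the dihedral group. -/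
theorem isListedCover_of_double_swap (h : CoverSetup 0 1 Γ φ π v₀ g) (hV : kleinGroup ≤ fixer φ v₀)
    (hg : φ g = swap 0 1 * swap 2 3) : IsListedCover Γ := by
  have hgS : φ g ∈ alternatingGroup (Fin 5) := by
    rw [hg, Perm.mem_alternatingGroup]; decide
  have hloc := isCoverPair_klein.exists_apply_eq
  have hmem : ∀ p ∈ alternatingGroup (Fin 5), p ∈ fixer φ v₀ → p ∈ kleinGroup := by
    intro p hp hpf
    by_contra hpV
    refine h.not_forall_mem_fixer hgS (fun j hj => ?_) (fun q hq hq0 => ?_)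
    · obtain ⟨p, hp, hpj⟩ := hloc j hj
      exact ⟨p, kleinGroup_le_alternatingGroup hp, hV hp, hpj⟩
    · refine pointedAlternating_le hV hpf ?_ hpV ?_
      · exact mem_pointedAlternating.2 ⟨h.apply_of_mem hpf, hp⟩
      · exact mem_pointedAlternating.2 ⟨hq0, hq⟩
  have hD : ∀ p ∈ alternatingGroup (Fin 5), p ∈ kleinGroup ↔
      p ∈ pointedCentralizer 0 (fourCycle ^ 2) := by
    simp only [mem_kleinGroup, mem_pointedCentralizer, Perm.mem_alternatingGroup]
    decide +kernel
  refine Or.inr (Or.inl (h.nonempty_iso (S := alternatingGroup (Fin 5)) isCoverPair_dihedral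
    (fun p hp => ?_) hgS ?_ (fun j hj => ?_)))
  · rw [← hD p hp]
    exact ⟨hmem p hp, fun hp => hV hp⟩
  · rw [hg, mem_pointedCentralizer]; decide
  · obtain ⟨p, hp, hpj⟩ := hloc j hj
    have hpA := kleinGroup_le_alternatingGroup hp
    exact ⟨p, hpA, (hD p hpA).1 hp, hpj⟩

theorem kleinGroup_le_relabel {τ : Perm (Fin 5)} (h0 : τ 0 = 0) (hV : kleinGroup ≤ fixer φ v₀) :
    kleinGroup ≤ fixer ((MulAut.conj τ).toMonoidHom.comp φ) v₀ := by
  intro p hp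
  have hconj : ∀ τ p : Perm (Fin 5), τ 0 = 0 →
      p ∈ [1, swap 1 2 * swap 3 4, swap 1 3 * swap 2 4, swap 1 4 * swap 2 3] →
      τ⁻¹ * p * τ ∈ [1, swap 1 2 * swap 3 4, swap 1 3 * swap 2 4, swap 1 4 * swap 2 3] := by
    decide +kernel
  have := mem_fixer_relabel τ
    (hV (mem_kleinGroup.2 (hconj τ p h0 (mem_kleinGroup.1 hp))))
  convert this using 1
  group

theorem isListedCover_of_double_swap' (h : CoverSetup 0 1 Γ φ π v₀ g)
    (hV : kleinGroup ≤ fixer φ v₀) {τ : Perm (Fin 5)} (h0 : τ 0 = 0) (h1 : τ 1 = 1)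
    (hg : τ * φ g * τ⁻¹ = swap 0 1 * swap 2 3) : IsListedCover Γ :=
  (h.relabel h0 h1).isListedCover_of_double_swap (kleinGroup_le_relabel h0 hV) hg

theorem mul_right {X : Type*} {x₀ x₁ : X} {φ : A →* Perm X} {π : V → X}
    (h : CoverSetup x₀ x₁ Γ φ π v₀ g) {a : A} (ha : a • v₀ = v₀) :
    CoverSetup x₀ x₁ Γ φ π v₀ (g * a) :=
  { h with
    apply_base := by
      rw [map_mul, Perm.mul_apply,
        h.apply_of_mem ((apply_mem_fixer_iff h.injective).2 ha), h.apply_base]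
    adj_base := by rw [mul_smul, ha]; exact h.adj_base }

/-- A fixer of even permutations is `V₄` or `A₄`, and both are listed. An odd element of the fixer,
multiplied into `g`, leads back to a double transposition. -/
theorem isListedCover_of_klein_of_swap (h : CoverSetup 0 1 Γ φ π v₀ g)
    (hV : kleinGroup ≤ fixer φ v₀) (hg : φ g = swap 0 1) : IsListedCover Γ := by
  by_cases hA : fixer φ v₀ ≤ pointedAlternating 0
  · have hloc := isCoverPair_klein.exists_apply_eq
    by_cases hK : fixer φ v₀ ≤ kleinGroup
    · exact Or.inr (Or.inr (Or.inl (h.nonempty_iso (S := ⊤) isCoverPair_klein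
        (fun p _ => ⟨fun hp => hK hp, fun hp => hV hp⟩) trivial
        (by rw [hg, inv_mul_cancel]; exact one_mem _)
        (fun j hj => by
          obtain ⟨p, hp, hpj⟩ := hloc j hj
          exact ⟨p, trivial, hp, hpj⟩))))
    · obtain ⟨p, hp, hpK⟩ := SetLike.not_le_iff_exists.1 hK
      have hle := pointedAlternating_le hV hp (hA hp) hpK
      exact Or.inl (h.nonempty_iso (S := ⊤) isCoverPair_alternating
        (fun p _ => ⟨fun hp => hA hp, fun hp => hle hp⟩) trivial
        (by rw [hg, inv_mul_cancel]; exact one_mem _)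
        (fun j hj => by
          obtain ⟨p, hp, hpj⟩ := isCoverPair_alternating.exists_apply_eq j hj
          exact ⟨p, trivial, hp, hpj⟩))
  · obtain ⟨p, hp, hpA⟩ := SetLike.not_le_iff_exists.1 hA
    -- Choosing `v` so that `v * p` fixes 1 leaves a transposition of `{2, 3, 4}`, which `τ`
    -- conjugates to `swap 2 3`.
    have hodd : ∀ p : Perm (Fin 5), p 0 = 0 → ¬ (p 0 = 0 ∧ Perm.sign p = 1) →
        ∃ v ∈ [1, swap 1 2 * swap 3 4, swap 1 3 * swap 2 4, swap 1 4 * swap 2 3],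
          ∃ τ ∈ [1, swap 2 4, swap 3 4],
          τ * (swap 0 1 * (v * p)) * τ⁻¹ = swap 0 1 * swap 2 3 := by
      decide +kernel
    obtain ⟨v, hv, τ, hτ, h2⟩ := hodd p (h.apply_of_mem hp)
      (fun hh => hpA (mem_pointedAlternating.2 hh))
    have hτ' : τ 0 = 0 ∧ τ 1 = 1 := by
      clear h2
      revert τ; decide +kernel
    obtain ⟨a, ha, hav⟩ := (fixer φ v₀).mul_mem (hV (mem_kleinGroup.2 hv)) hp
    refine (h.mul_right ha).isListedCover_of_double_swap' hV hτ'.1 hτ'.2 ?_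
    rw [map_mul, hav, hg, h2]

theorem isListedCover_of_klein (h : CoverSetup 0 1 Γ φ π v₀ g)
    (hV : kleinGroup ≤ fixer φ v₀) {q : Perm (Fin 5)} (hq0 : q 0 = 1) (hq1 : q 1 = 0)
    (hg : φ g = q ^ 3) : IsListedCover Γ := by
  rcases cube_of_swapping q hq0 hq1 with e | e | e | e <;> rw [e] at hg
  · exact h.isListedCover_of_klein_of_swap hV hg
  · exact h.isListedCover_of_double_swap hV hg
  · exact h.isListedCover_of_double_swap' hV (τ := swap 3 4) (by decide) (by decide)
      (by rw [hg]; decide)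
  · exact h.isListedCover_of_double_swap' hV (τ := swap 2 4) (by decide) (by decide)
      (by rw [hg]; decide)

/-- Modulo 5, `fourCycle` is `x ↦ 2x` and `swap 0 1 * swap 2 4` is `x ↦ 1 - x`. Both are affine, and
the affine permutations fixing 0 are the powers of `fourCycle`, which already fix `v₀`. -/
theorem not_affine (h : CoverSetup 0 1 Γ φ π v₀ g) (hc : fourCycle ∈ fixer φ v₀) :
    φ g ≠ swap 0 1 * swap 2 4 := by
  intro hg
  have hcA : fourCycle ∈ affineGroup := by rw [mem_affineGroup]; decide
  refine h.not_forall_mem_fixer (S := affineGroup) ?_ (fun j hj => ?_) (fun p hp hp0 => ?_)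
  · rw [hg, mem_affineGroup]; decide
  · obtain ⟨p, hp, -, hpj⟩ := exists_fourCycle_pow
      (K := affineGroup ⊓ fixer φ v₀) ⟨hcA, hc⟩ j hj
    exact ⟨p, hp.1, hp.2, hpj⟩
  · have : p ∈ pointedCentralizer 0 fourCycle := by
      rw [mem_pointedCentralizer]
      rw [mem_affineGroup] at hp
      revert p
      decide +kernel
    obtain ⟨k, rfl⟩ := mem_pointedCentralizer_fourCycle.1 this
    exact Subgroup.pow_mem _ hc _

/-- A 4-cycle together with any permutation of the nonzero points outside its powers generates `D₈`
or `S₄`, so the fixer is either `C₄` or contains `V₄`. -/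
theorem isListedCover_of_fourCycle (h : CoverSetup 0 1 Γ φ π v₀ g)
    (hc : fourCycle ∈ fixer φ v₀) {q : Perm (Fin 5)} (hq0 : q 0 = 1) (hq1 : q 1 = 0)
    (hg : φ g = q ^ 3) : IsListedCover Γ := by
  by_cases hC : fixer φ v₀ ≤ pointedCentralizer 0 fourCycle
  · have hS : ∀ p ∈ (⊤ : Subgroup (Perm (Fin 5))), p ∈ fixer φ v₀ ↔
        p ∈ pointedCentralizer 0 fourCycle := by
      refine fun p _ => ⟨fun hp => hC hp, fun hp => ?_⟩
      obtain ⟨k, rfl⟩ := mem_pointedCentralizer_fourCycle.1 hp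
      exact Subgroup.pow_mem _ hc _
    have hloc : ∀ j : Fin 5, j ≠ 0 → ∃ p ∈ (⊤ : Subgroup (Perm (Fin 5))),
        p ∈ pointedCentralizer 0 fourCycle ∧ p 1 = j := fun j hj => by
      obtain ⟨p, hp, -, hpj⟩ := exists_fourCycle_pow fourCycle_mem j hj
      exact ⟨p, trivial, hp, hpj⟩
    rcases cube_of_swapping q hq0 hq1 with e | e | e | e <;> rw [e] at hg
    · exact Or.inr (Or.inr (Or.inr (Or.inl (h.nonempty_iso isCoverPair_cyclic_swap hS trivial
        (by rw [hg, inv_mul_cancel]; exact one_mem _) hloc))))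
    · exact Or.inr (Or.inr (Or.inr (Or.inr (h.nonempty_iso isCoverPair_cyclic_swap_mul_swap hS
        trivial (by rw [hg, inv_mul_cancel]; exact one_mem _) hloc))))
    · exact absurd hg (h.not_affine hc)
    -- Conjugation by `swap 2 3` inverts `fourCycle` and turns `swap 0 1 * swap 3 4` into the affine
    -- `swap 0 1 * swap 2 4`.
    · refine absurd ?_ ((h.relabel (τ := swap 2 3) (by decide) (by decide)).not_affine ?_)
      · change swap 2 3 * φ g * (swap 2 3)⁻¹ = _
        rw [hg]; decide
      · have := mem_fixer_relabel (swap 2 3) (Subgroup.inv_mem _ hc)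
        convert this using 1
        decide
  · obtain ⟨p, hp, hpC⟩ := SetLike.not_le_iff_exists.1 hC
    have key : ∀ p : Perm (Fin 5), p 0 = 0 → ¬ (p 0 = 0 ∧ p * fourCycle = fourCycle * p) →
        ∃ i j k l : Fin 4, fourCycle ^ (i : ℕ) * p ^ (j : ℕ) * fourCycle ^ (k : ℕ) * p ^ (l : ℕ) =
          swap 1 2 * swap 3 4 := by
      decide +kernel
    obtain ⟨i, j, k, l, hw⟩ := key p (h.apply_of_mem hp)
      (fun hh => hpC (mem_pointedCentralizer.2 hh))
    refine h.isListedCover_of_klein (kleinGroup_le ?_ ?_) hq0 hq1 hg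
    · rw [← hw]
      exact Subgroup.mul_mem _ (Subgroup.mul_mem _ (Subgroup.mul_mem _ (Subgroup.pow_mem _ hc _)
        (Subgroup.pow_mem _ hp _)) (Subgroup.pow_mem _ hc _)) (Subgroup.pow_mem _ hp _)
    · rw [show (swap 1 4 * swap 2 3 : Perm (Fin 5)) = fourCycle ^ 2 by decide]
      exact Subgroup.pow_mem _ hc _

end CoverSetup

end Classification

section Classification

/-- The transitive subgroups of `S₄` are `C₄`, `V₄`, `D₈`, `A₄` and `S₄`; those without a 4-cycle
contain `V₄`. The check uses short words in elements sending 1 to 2, 3 and 4. -/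
theorem kleinGroup_le_or_exists_fourCycle {H : Subgroup (Perm (Fin 5))} (h0 : ∀ p ∈ H, p 0 = 0)
    (hH : ∀ j : Fin 5, j ≠ 0 → ∃ p ∈ H, p 1 = j) :
    kleinGroup ≤ H ∨ ∃ p ∈ H, ∃ τ : Perm (Fin 5), τ 0 = 0 ∧ τ 1 = 1 ∧ τ * p * τ⁻¹ = fourCycle := by
  have key : ∀ a : Perm (Fin 5), a 0 = 0 ∧ a 1 = 2 → ∀ b : Perm (Fin 5), b 0 = 0 ∧ b 1 = 3 →
      ∀ c : Perm (Fin 5), c 0 = 0 ∧ c 1 = 4 →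
      (∃ p ∈ [a, b, c, a * b, a * c, b * c, a * (b * c)], p * p ≠ 1 ∧ p * p * (p * p) = 1) ∨
      (∃ x ∈ [1, a, b, c], ∃ y ∈ [1, a, b, c], ∃ z ∈ [1, a, b, c],
        x * y * z = swap 1 2 * swap 3 4) ∧
      (∃ x ∈ [1, a, b, c], ∃ y ∈ [1, a, b, c], ∃ z ∈ [1, a, b, c],
        x * y * z = swap 1 4 * swap 2 3) := by
    decide +kernel
  have hτ : ∀ p : Perm (Fin 5), p 0 = 0 ∧ p * p ≠ 1 ∧ p * p * (p * p) = 1 →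
      ∃ τ : Perm (Fin 5), τ 0 = 0 ∧ τ 1 = 1 ∧ τ * p * τ⁻¹ = fourCycle := by
    decide +kernel
  obtain ⟨a, ha, ha1⟩ := hH 2 (by decide)
  obtain ⟨b, hb, hb1⟩ := hH 3 (by decide)
  obtain ⟨c, hc, hc1⟩ := hH 4 (by decide)
  have hmem : ∀ x ∈ [1, a, b, c], x ∈ H := by
    simp only [List.forall_mem_cons]
    exact ⟨H.one_mem, ha, hb, hc, by simp⟩
  rcases key a ⟨h0 a ha, ha1⟩ b ⟨h0 b hb, hb1⟩ c ⟨h0 c hc, hc1⟩ with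
    ⟨p, hp, hp4⟩ | ⟨⟨x, hx, y, hy, z, hz, h1⟩, x', hx', y', hy', z', hz', h2⟩
  · have hpH : p ∈ H := by
      revert p
      simp only [List.forall_mem_cons]
      exact ⟨fun _ => ha, fun _ => hb, fun _ => hc, fun _ => H.mul_mem ha hb,
        fun _ => H.mul_mem ha hc, fun _ => H.mul_mem hb hc,
        fun _ => H.mul_mem ha (H.mul_mem hb hc), by simp⟩
    exact Or.inr ⟨p, hpH, hτ p ⟨h0 p hpH, hp4⟩⟩
  · exact Or.inl (kleinGroup_le
      (h1 ▸ H.mul_mem (H.mul_mem (hmem x hx) (hmem y hy)) (hmem z hz))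
      (h2 ▸ H.mul_mem (H.mul_mem (hmem x' hx') (hmem y' hy')) (hmem z' hz')))

theorem isListedCover_of_isFaithfulArcTransitiveCover {V : Type*} {Γ : SimpleGraph V}
    (hc : Γ.Connected) (h : IsFaithfulArcTransitiveCover Γ (K 5)) : IsListedCover Γ := by
  obtain ⟨G, φ, π, v₀, g, hs, q, hq0, hq1, hg⟩ :=
    exists_coverSetup hc h (show (0 : Fin 5) ≠ 1 by decide)
  rcases kleinGroup_le_or_exists_fourCycle (fun p hp => hs.apply_of_mem hp)
    (fun j hj => hs.exists_mem_fixer hj) with hV | ⟨p, hp, τ, h0, h1, hτ⟩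
  · exact hs.isListedCover_of_klein hV hq0 hq1 hg
  · refine (hs.relabel h0 h1).isListedCover_of_fourCycle
      (hτ ▸ CoverSetup.mem_fixer_relabel τ hp) (q := τ * q * τ⁻¹) ?_ ?_ ?_
    · simp only [Perm.mul_apply, Perm.inv_eq_iff_eq.2 h0.symm, hq0, h1]
    · simp only [Perm.mul_apply, Perm.inv_eq_iff_eq.2 h1.symm, hq1, h0]
    · change τ * φ g * τ⁻¹ = _
      rw [hg, conj_pow]

theorem IsCoverPair.isFaithfulArcTransitiveCover {V X : Type*} [DecidableEq X] [Nontrivial X]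
    {Γ : SimpleGraph V} {x₀ x₁ : X} {L : Subgroup (Perm X)} {γ : Perm X}
    (h : IsCoverPair x₀ x₁ L γ) (e : Γ ≃g cosetGraph h.toIsCosetPair) :
    Γ.Connected ∧ IsFaithfulArcTransitiveCover Γ (SimpleGraph.completeGraph X) :=
  ⟨e.connected_iff.2 h.connected,
    isFaithfulArcTransitiveCover_of_iso e h.blockAction Function.injective_id h.uniqueLifting⟩

theorem connected_and_isFaithfulArcTransitiveCover_iff {V : Type*} {Γ : SimpleGraph V} :
    (Γ.Connected ∧ IsFaithfulArcTransitiveCover Γ (K 5)) ↔ IsListedCover Γ := by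
  constructor
  · rintro ⟨hc, h⟩
    exact isListedCover_of_isFaithfulArcTransitiveCover hc h
  · rintro (⟨⟨e⟩⟩ | ⟨⟨e⟩⟩ | ⟨⟨e⟩⟩ | ⟨⟨e⟩⟩ | ⟨⟨e⟩⟩)
    · exact isCoverPair_alternating.isFaithfulArcTransitiveCover e
    · exact isCoverPair_dihedral.isFaithfulArcTransitiveCover e
    · exact isCoverPair_klein.isFaithfulArcTransitiveCover e
    · exact isCoverPair_cyclic_swap.isFaithfulArcTransitiveCover e
    · exact isCoverPair_cyclic_swap_mul_swap.isFaithfulArcTransitiveCover e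

end Classification

/-! ### Closed walks and vertex counts that separate the covers -/

section Invariants

variable {V W : Type*}

/-- The graph has a triangle. -/
def HasTriangle (Γ : SimpleGraph V) : Prop :=
  ∃ a b c, Γ.Adj a b ∧ Γ.Adj b c ∧ Γ.Adj c a

/-- The graph has a closed walk of length five. -/
def HasClosedFiveWalk (Γ : SimpleGraph V) : Prop :=
  ∃ a b c d e, Γ.Adj a b ∧ Γ.Adj b c ∧ Γ.Adj c d ∧ Γ.Adj d e ∧ Γ.Adj e a

theorem HasTriangle.of_iso {Γ : SimpleGraph V} {Δ : SimpleGraph W} (f : Γ ≃g Δ)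
    (h : HasTriangle Γ) : HasTriangle Δ := by
  obtain ⟨a, b, c, h1, h2, h3⟩ := h
  exact ⟨f a, f b, f c, f.map_adj_iff.2 h1, f.map_adj_iff.2 h2, f.map_adj_iff.2 h3⟩

theorem HasClosedFiveWalk.of_iso {Γ : SimpleGraph V} {Δ : SimpleGraph W} (f : Γ ≃g Δ)
    (h : HasClosedFiveWalk Γ) : HasClosedFiveWalk Δ := by
  obtain ⟨a, b, c, d, e, h1, h2, h3, h4, h5⟩ := h
  exact ⟨f a, f b, f c, f d, f e, f.map_adj_iff.2 h1, f.map_adj_iff.2 h2, f.map_adj_iff.2 h3,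
    f.map_adj_iff.2 h4, f.map_adj_iff.2 h5⟩

namespace IsCosetPair

variable {X : Type*} {x₀ x₁ : X} {L : Subgroup (Perm X)} {γ : Perm X}

theorem adj_mk_mul (h : IsCosetPair x₀ x₁ L γ) (p : Perm X) {s : Perm X} (hs : s ∈ L) :
    (cosetGraph h).Adj (p : Perm X ⧸ L) ((p * s * γ : Perm X) : Perm X ⧸ L) :=
  ⟨p * s, by rw [eq_comm, QuotientGroup.eq]; simpa using hs, rfl⟩

theorem hasTriangle (h : IsCosetPair x₀ x₁ L γ) {s t u : Perm X} (hs : s ∈ L) (ht : t ∈ L)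
    (hu : u ∈ L) (hw : s * γ * t * γ * u * γ ∈ L) : HasTriangle (cosetGraph h) := by
  refine ⟨_, _, _, h.adj_mk_mul 1 hs, h.adj_mk_mul _ ht, ?_⟩
  convert h.adj_mk_mul _ hu using 1
  rw [QuotientGroup.eq]
  simpa using hw

theorem hasClosedFiveWalk (h : IsCosetPair x₀ x₁ L γ) {s t u v w : Perm X} (hs : s ∈ L)
    (ht : t ∈ L) (hu : u ∈ L) (hv : v ∈ L) (hw : w ∈ L)
    (hp : s * γ * t * γ * u * γ * v * γ * w * γ ∈ L) : HasClosedFiveWalk (cosetGraph h) := by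
  refine ⟨_, _, _, _, _, h.adj_mk_mul 1 hs, h.adj_mk_mul _ ht, h.adj_mk_mul _ hu,
    h.adj_mk_mul _ hv, ?_⟩
  convert h.adj_mk_mul _ hw using 1
  rw [QuotientGroup.eq]
  simpa using hp

/-- A triangle can be moved onto the arc from `L` to `γ L`; its third vertex is then both `s γ L`
and `γ t γ L`. -/
theorem not_hasTriangle (h : IsCosetPair x₀ x₁ L γ)
    (hL : ∀ s ∈ L, ∀ t ∈ L, (s * γ)⁻¹ * (γ * t * γ) ∉ L) : ¬ HasTriangle (cosetGraph h) := by
  rintro ⟨a, b, c, hab, hbc, hca⟩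
  have hl := h.locallyTransitive
  obtain ⟨r, hr1, hr2⟩ := hl.arc_transitive h.connected hab hl.adj_base
  have h1 := hl.adj_smul r hca.symm
  have h2 := hl.adj_smul (γ⁻¹ * r) hbc
  rw [hr1, h.adj_mk_one_iff] at h1
  rw [mul_smul, hr2, inv_smul_smul, h.adj_mk_one_iff] at h2
  obtain ⟨s, hs, hs'⟩ := h1
  obtain ⟨t, ht, ht'⟩ := h2
  rw [mul_smul, ← hs', eq_inv_smul_iff, eq_comm, MulAction.Quotient.smul_coe, QuotientGroup.eq,
    smul_eq_mul, ← mul_assoc] at ht'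
  exact hL s hs t ht ht'

/-- The sign is constant on cosets of `L` and changes along every edge, so the graph is bipartite.
-/
theorem not_hasClosedFiveWalk [DecidableEq X] [Fintype X] (h : IsCosetPair x₀ x₁ L γ)
    (hL : L ≤ alternatingGroup X) (hγ : Perm.sign γ = -1) :
    ¬ HasClosedFiveWalk (cosetGraph h) := by
  let f : Perm X ⧸ L → ℤˣ := fun a => Quotient.liftOn' a Perm.sign (fun p q hpq => by
    have := hL (QuotientGroup.leftRel_apply.1 hpq)
    rw [Perm.mem_alternatingGroup, map_mul, map_inv, inv_mul_eq_one] at this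
    exact this)
  have hf : ∀ {a b}, (cosetGraph h).Adj a b → f b = - f a := by
    rintro _ _ ⟨p, rfl, rfl⟩
    change Perm.sign (p * γ) = - Perm.sign p
    rw [map_mul, hγ, mul_neg_one]
  rintro ⟨a, b, c, d, e, h1, h2, h3, h4, h5⟩
  have h6 := hf h5
  rw [hf h4, hf h3, hf h2, hf h1] at h6
  simp only [neg_neg] at h6
  exact units_ne_neg_self _ h6

end IsCosetPair

theorem natCard_quotient_eq {L : Subgroup (Perm (Fin 5))} {k : ℕ} (h : k * Nat.card L = 120)
    (hL : Nat.card L ≠ 0) : Nat.card (Perm (Fin 5) ⧸ L) = k := by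
  have := L.card_eq_card_quotient_mul_card_subgroup
  rw [Nat.card_perm, Nat.card_fin, ← show 120 = Nat.factorial 5 from rfl, ← h] at this
  exact (Nat.eq_of_mul_eq_mul_right (Nat.pos_of_ne_zero hL) this).symm

theorem natCard_eq_of_mem_iff {L : Subgroup (Perm (Fin 5))} {P : Perm (Fin 5) → Prop}
    [DecidablePred P] (h : ∀ {p}, p ∈ L ↔ P p) : Nat.card L = Fintype.card {p // P p} := by
  rw [← Nat.card_eq_fintype_card]
  exact Nat.card_congr (Equiv.subtypeEquivRight fun p => h)

theorem natCard_pointedAlternating : Nat.card (pointedAlternating (0 : Fin 5)) = 12 := by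
  rw [natCard_eq_of_mem_iff mem_pointedAlternating]
  decide +kernel

theorem natCard_pointedCentralizer_sq :
    Nat.card (pointedCentralizer 0 (fourCycle ^ 2)) = 8 := by
  rw [natCard_eq_of_mem_iff mem_pointedCentralizer]
  decide +kernel

theorem natCard_kleinGroup : Nat.card kleinGroup = 4 := by
  rw [natCard_eq_of_mem_iff mem_kleinGroup]
  decide +kernel

theorem natCard_pointedCentralizer_fourCycle :
    Nat.card (pointedCentralizer 0 fourCycle) = 4 := by
  rw [natCard_eq_of_mem_iff mem_pointedCentralizer]
  decide +kernel

theorem fourCycle_pow_mem (k : ℕ) : fourCycle ^ k ∈ pointedCentralizer 0 fourCycle :=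
  Subgroup.pow_mem _ fourCycle_mem k

theorem hasTriangle_cyclic_swap_mul_swap :
    HasTriangle (cosetGraph isCoverPair_cyclic_swap_mul_swap.toIsCosetPair) := by
  have : ∃ i j k : Fin 4, fourCycle ^ (i : ℕ) * (swap 0 1 * swap 2 3) * fourCycle ^ (j : ℕ) *
      (swap 0 1 * swap 2 3) * fourCycle ^ (k : ℕ) * (swap 0 1 * swap 2 3) = 1 := by
    decide +kernel
  obtain ⟨i, j, k, h⟩ := this
  exact IsCosetPair.hasTriangle _ (fourCycle_pow_mem i) (fourCycle_pow_mem j)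
    (fourCycle_pow_mem k) (h ▸ Subgroup.one_mem _)

theorem hasClosedFiveWalk_cyclic_swap :
    HasClosedFiveWalk (cosetGraph isCoverPair_cyclic_swap.toIsCosetPair) := by
  have : ∃ i j k l m : Fin 4, fourCycle ^ (i : ℕ) * swap 0 1 * fourCycle ^ (j : ℕ) *
      swap 0 1 * fourCycle ^ (k : ℕ) * swap 0 1 * fourCycle ^ (l : ℕ) * swap 0 1 *
      fourCycle ^ (m : ℕ) * swap 0 1 = 1 := by
    decide +kernel
  obtain ⟨i, j, k, l, m, h⟩ := this
  exact IsCosetPair.hasClosedFiveWalk _ (fourCycle_pow_mem i) (fourCycle_pow_mem j)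
    (fourCycle_pow_mem k) (fourCycle_pow_mem l) (fourCycle_pow_mem m) (h ▸ Subgroup.one_mem _)

theorem not_hasTriangle_cyclic_swap :
    ¬ HasTriangle (cosetGraph isCoverPair_cyclic_swap.toIsCosetPair) := by
  apply IsCosetPair.not_hasTriangle
  have : ∀ i j : Fin 4, ∀ k : Fin 4, (fourCycle ^ (i : ℕ) * swap 0 1)⁻¹ *
      (swap 0 1 * fourCycle ^ (j : ℕ) * swap 0 1) ≠ fourCycle ^ (k : ℕ) := by
    decide +kernel
  intro s hs t ht h
  obtain ⟨i, rfl⟩ := mem_pointedCentralizer_fourCycle.1 hs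
  obtain ⟨j, rfl⟩ := mem_pointedCentralizer_fourCycle.1 ht
  obtain ⟨k, hk⟩ := mem_pointedCentralizer_fourCycle.1 h
  exact this i j k hk

theorem not_hasTriangle_klein : ¬ HasTriangle (cosetGraph isCoverPair_klein.toIsCosetPair) := by
  apply IsCosetPair.not_hasTriangle
  simp only [mem_kleinGroup]
  decide +kernel

theorem not_hasClosedFiveWalk_klein :
    ¬ HasClosedFiveWalk (cosetGraph isCoverPair_klein.toIsCosetPair) :=
  IsCosetPair.not_hasClosedFiveWalk _ kleinGroup_le_alternatingGroup (by decide)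

end Invariants

/-! ### The covers of `K₄` -/

section Cube

theorem isCoverPair_alternating_four :
    IsCoverPair (0 : Fin 4) 1 (pointedAlternating 0) (swap 0 1) where
  mul_self := by decide
  apply_base := by decide
  ne := by decide
  apply_of_mem p hp := (mem_pointedAlternating.1 hp).1
  exists_notMem := ⟨swap 1 2, by decide, by rw [mem_pointedAlternating]; decide⟩
  eq_top K hL hγ := eq_top_of_swap_mem (by decide) hγ fun j hj => by
    have : ∀ j : Fin 4, j ≠ 0 → ∃ p : Perm (Fin 4), (p 0 = 0 ∧ Perm.sign p = 1) ∧ p 1 = j := by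
      decide +kernel
    obtain ⟨p, hp, hpj⟩ := this j hj
    exact ⟨p, hL (mem_pointedAlternating.2 hp), hp.1, hpj⟩
  exists_apply_eq := by
    simp only [mem_pointedAlternating]
    decide +kernel
  conj_mem := by
    simp only [mem_pointedAlternating]
    decide +kernel

/-- A group transitive on three points contains the 3-cycles, which appear among words of length at
most two in `a` and `b`. -/
theorem pointedAlternating_four_le {H : Subgroup (Perm (Fin 4))} (h0 : ∀ p ∈ H, p 0 = 0)
    (hH : ∀ j : Fin 4, j ≠ 0 → ∃ p ∈ H, p 1 = j) : pointedAlternating 0 ≤ H := by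
  have key : ∀ a b : Perm (Fin 4), a 0 = 0 ∧ a 1 = 2 → b 0 = 0 ∧ b 1 = 3 →
      ∀ p : Perm (Fin 4), p 0 = 0 ∧ Perm.sign p = 1 →
        p ∈ [1, a, b, a * b, b * a, a * a, b * b] := by
    decide +kernel
  obtain ⟨a, ha, ha1⟩ := hH 2 (by decide)
  obtain ⟨b, hb, hb1⟩ := hH 3 (by decide)
  intro p hp
  have := key a b ⟨h0 a ha, ha1⟩ ⟨h0 b hb, hb1⟩ p (mem_pointedAlternating.1 hp)
  revert this p
  simp only [List.mem_cons, List.not_mem_nil, or_false]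
  rintro p - (rfl | rfl | rfl | rfl | rfl | rfl | rfl)
  · exact H.one_mem
  · exact ha
  · exact hb
  · exact H.mul_mem ha hb
  · exact H.mul_mem hb ha
  · exact H.mul_mem ha ha
  · exact H.mul_mem hb hb

/-- The fixer is `C₃` or `S₃`. An even `φ g` is impossible since `C₃` is the full point stabilizer
in `A₄`, and `S₃` is impossible since it is the full one in `S₄`. What remains is `C₃` with `swap 0
1`. -/
theorem nonempty_iso_of_isFaithfulArcTransitiveCover_four {V : Type*} {Γ : SimpleGraph V}
    (hc : Γ.Connected) (h : IsFaithfulArcTransitiveCover Γ (K 4)) :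
    Nonempty (Γ ≃g cosetGraph isCoverPair_alternating_four.toIsCosetPair) := by
  obtain ⟨G, φ, π, v₀, g, hs, q, hq0, hq1, hg⟩ :=
    exists_coverSetup hc h (show (0 : Fin 4) ≠ 1 by decide)
  have hle := pointedAlternating_four_le (fun p hp => hs.apply_of_mem hp)
    (fun j hj => hs.exists_mem_fixer hj)
  have hq : ∀ q : Perm (Fin 4), q 0 = 1 → q 1 = 0 → q ^ 3 = swap 0 1 ∨ Perm.sign (q ^ 3) = 1 := by
    decide +kernel
  have hloc := isCoverPair_alternating_four.exists_apply_eq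
  rcases hq q hq0 hq1 with e | e <;> rw [← hg] at e
  · by_cases hA : fixer φ v₀ ≤ pointedAlternating 0
    · exact hs.nonempty_iso (S := ⊤) isCoverPair_alternating_four
        (fun p _ => ⟨fun hp => hA hp, fun hp => hle hp⟩) trivial
        (by rw [e, inv_mul_cancel]; exact one_mem _)
        (fun j hj => by
          obtain ⟨p, hp, hpj⟩ := hloc j hj
          exact ⟨p, trivial, hp, hpj⟩)
    · obtain ⟨p, hp, hpA⟩ := SetLike.not_le_iff_exists.1 hA
      have hp0 := hs.apply_of_mem hp
      have hps : Perm.sign p = -1 := (Int.units_eq_one_or _).resolve_left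
        (fun hh => hpA (mem_pointedAlternating.2 ⟨hp0, hh⟩))
      refine absurd (fun r _ hr => ?_) (hs.not_forall_mem_fixer (S := ⊤) trivial (fun j hj => ?_))
      · rcases Int.units_eq_one_or (Perm.sign r) with hh | hh
        · exact hle (mem_pointedAlternating.2 ⟨hr, hh⟩)
        · refine (Subgroup.mul_mem_cancel_left _ hp).1 (hle (mem_pointedAlternating.2 ⟨?_, ?_⟩))
          · rw [Perm.mul_apply, hr, hp0]
          · rw [map_mul, hps, hh]; rfl
      · obtain ⟨p, hp, hpj⟩ := hloc j hj
        exact ⟨p, trivial, hle hp, hpj⟩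
  · refine absurd (fun r hr hr0 => ?_)
      (hs.not_forall_mem_fixer (S := alternatingGroup (Fin 4)) e (fun j hj => ?_))
    · exact hle (mem_pointedAlternating.2 ⟨hr0, hr⟩)
    · obtain ⟨p, hp, hpj⟩ := hloc j hj
      exact ⟨p, (mem_pointedAlternating.1 hp).2, hle hp, hpj⟩

/-- The vertex of the cube attached to a permutation of its four diagonals: the even-weight end of
the image of the first diagonal, or its antipode if the permutation is odd. -/
def cubeVertex (p : Perm (Fin 4)) : Fin 3 → Bool :=
  fun i => xor (decide (p 0 ≠ 0 ∧ p 0 ≠ i.succ)) (decide (Perm.sign p = -1))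

theorem cubeVertex_eq_iff : ∀ p q : Perm (Fin 4), cubeVertex p = cubeVertex q ↔
    ((p⁻¹ * q) 0 = 0 ∧ Perm.sign (p⁻¹ * q) = 1) := by
  decide +kernel

/-- A coset of `C₃` is a diagonal together with a sign, that is, one end of the diagonal. Adjacent
vertices lie on different diagonals and have opposite signs. -/
theorem nonempty_iso_cubeGraph :
    Nonempty (cosetGraph isCoverPair_alternating_four.toIsCosetPair ≃g cubeGraph) := by
  have hmem : ∀ p q : Perm (Fin 4), cubeVertex p = cubeVertex q ↔
      (p : Perm (Fin 4) ⧸ pointedAlternating (0 : Fin 4)) = q := by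
    intro p q
    rw [cubeVertex_eq_iff, QuotientGroup.eq, mem_pointedAlternating]
  let f : Perm (Fin 4) ⧸ pointedAlternating (0 : Fin 4) → Fin 3 → Bool :=
    fun a => Quotient.liftOn' a cubeVertex
      (fun p q hpq => (hmem p q).2 (Quotient.sound' hpq))
  have hf : Function.Bijective f := by
    constructor
    · intro a b
      induction a using QuotientGroup.induction_on with | _ p =>
      induction b using QuotientGroup.induction_on with | _ q =>
      exact (hmem p q).1
    · have : ∀ x : Fin 3 → Bool, ∃ p, cubeVertex p = x := by decide +kernel
      intro x
      obtain ⟨p, hp⟩ := this x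
      exact ⟨(p : Perm (Fin 4) ⧸ pointedAlternating (0 : Fin 4)), hp⟩
  refine ⟨⟨Equiv.ofBijective f hf, ?_⟩⟩
  intro a b
  induction a using QuotientGroup.induction_on with | _ p =>
  induction b using QuotientGroup.induction_on with | _ q =>
  have h1 : ∀ p q : Perm (Fin 4), hammingDist (cubeVertex p) (cubeVertex q) = 1 ↔
      ((p⁻¹ * q) 0 ≠ 0 ∧ Perm.sign (p⁻¹ * q) = -1) := by
    decide +kernel
  have h2 : ∀ r : Perm (Fin 4), (r 0 ≠ 0 ∧ Perm.sign r = -1) ↔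
      ∃ s : Perm (Fin 4), (s 0 = 0 ∧ Perm.sign s = 1) ∧
        (((s * swap 0 1)⁻¹ * r) 0 = 0 ∧ Perm.sign ((s * swap 0 1)⁻¹ * r) = 1) := by
    decide +kernel
  change hammingDist (cubeVertex p) (cubeVertex q) = 1 ↔ _
  rw [h1, h2, ← adj_smul_iff isCoverPair_alternating_four.locallyTransitive.adj_smul p⁻¹,
    MulAction.Quotient.smul_coe, smul_eq_mul, inv_mul_cancel, IsCosetPair.adj_mk_one_iff]
  refine exists_congr fun s => and_congr mem_pointedAlternating.symm ?_
  rw [MulAction.Quotient.smul_coe, QuotientGroup.eq, mem_pointedAlternating, smul_eq_mul]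

theorem connected_and_isFaithfulArcTransitiveCover_four_iff {V : Type*} {Γ : SimpleGraph V} :
    (Γ.Connected ∧ IsFaithfulArcTransitiveCover Γ (K 4)) ↔ Nonempty (Γ ≃g cubeGraph) := by
  obtain ⟨f⟩ := nonempty_iso_cubeGraph
  constructor
  · rintro ⟨hc, h⟩
    obtain ⟨e⟩ := nonempty_iso_of_isFaithfulArcTransitiveCover_four hc h
    exact ⟨e.trans f⟩
  · rintro ⟨e⟩
    exact isCoverPair_alternating_four.isFaithfulArcTransitiveCover (e.trans f.symm)

end Cube

/-! ### Pseudocovers -/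

section Pseudocovers

variable {V A X : Type*} [Group A] [MulAction A V] {Γ : SimpleGraph V} {φ : A →* Perm X}
  {π : V → X}

namespace BlockAction

/-- If one neighbour were alone in its part, arc-transitivity would make all neighbours so.
Neighbourhoods would then inject into the other parts and, by the valency, fill them: a cover. -/
theorem exists_ne_of_not_uniqueLifting [Finite X] [Nontrivial X] (h : BlockAction Γ φ π) {k : ℕ}
    (hk : k + 1 = Nat.card X) (hΓ : HasValency Γ k) (hl : ¬ UniqueLifting Γ π) {v w : V}
    (hvw : Γ.Adj v w) : ∃ w', w' ≠ w ∧ Γ.Adj v w' ∧ π w' = π w := by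
  by_contra! hno
  apply hl
  have hinj : ∀ u, Set.InjOn π (Γ.neighborSet u) := by
    intro u x hx y hy hxy
    by_contra hne
    obtain ⟨s, rfl, rfl⟩ := h.arc_transitive hvw hx
    refine hno (s⁻¹ • y) (fun e => hne (by rw [← e, smul_inv_smul])) ?_ ?_
    · have := h.adj_smul s⁻¹ hy
      rwa [inv_smul_smul] at this
    · rw [h.map_smul, ← hxy, h.map_smul]; simp
  intro u j hj
  have himg : π '' Γ.neighborSet u = {π u}ᶜ := by
    apply Set.Finite.eq_of_subset_of_encard_le (Set.toFinite _)
    · rintro _ ⟨x, hx, rfl⟩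
      exact (h.map_ne hx).symm
    · rw [(hinj u).encard_image, hΓ u]
      have h1 : ({π u}ᶜ : Set X).encard + 1 = Nat.card X := by
        rw [Set.compl_eq_univ_sdiff, Set.encard_sdiff_singleton_add_one (Set.mem_univ _),
          Set.encard_univ, ENat.card_eq_coe_natCard]
      rw [← hk, Nat.cast_add, Nat.cast_one] at h1
      exact (ENat.add_left_injective_of_ne_top ENat.one_ne_top h1).le
  have : j ∈ π '' Γ.neighborSet u := by rw [himg]; exact hj
  obtain ⟨w, hw, rfl⟩ := this
  exact ⟨w, ⟨hw, rfl⟩, fun y hy => hinj u hy.1 hw hy.2⟩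

/-- If every vertex saw only one part, a walk starting along an edge over `x` and `y` would
alternate between these two parts and never get to `z`. -/
theorem exists_adj_of_connected (h : BlockAction Γ φ π) (hc : Γ.Connected) {x y z : X}
    (hxy : x ≠ y) (hxz : x ≠ z) (hyz : y ≠ z) :
    ∃ v w w', Γ.Adj v w ∧ Γ.Adj v w' ∧ π w ≠ π w' := by
  by_contra! hno
  obtain ⟨v, w, hvw, hv, hw⟩ := h.exists_adj hxy
  obtain ⟨u, -, -, hu, -⟩ := h.exists_adj hxz.symm
  have key : ∀ a b, Γ.Walk a b → (π a = x ∧ ∀ c, Γ.Adj a c → π c = y) ∨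
      (π a = y ∧ ∀ c, Γ.Adj a c → π c = x) → π b = x ∨ π b = y := by
    intro a b p
    induction p with
    | nil => exact fun hh => hh.imp And.left And.left
    | @cons a b c hab p ih =>
      rintro (⟨h1, h2⟩ | ⟨h1, h2⟩)
      · exact ih (Or.inr ⟨h2 _ hab, fun d hd => by rw [← h1]; exact hno _ _ _ hd hab.symm⟩)
      · exact ih (Or.inl ⟨h2 _ hab, fun d hd => by rw [← h1]; exact hno _ _ _ hd hab.symm⟩)
  obtain ⟨p⟩ := hc.preconnected v u
  rcases key v u p (Or.inl ⟨hv, fun c hc => by rw [← hw]; exact hno _ _ _ hc hvw⟩) with e | e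
  · exact hxz (e.symm.trans hu)
  · exact hyz (e.symm.trans hu)

end BlockAction

/-- The neighbours of some vertex of a pseudocover of a complete graph include two vertices in each
of two blocks. -/
theorem BlockAction.exists_four_neighbors [Finite X] (h : BlockAction Γ φ π) (hc : Γ.Connected)
    {k : ℕ} (hk : k + 1 = Nat.card X) (hk2 : 2 ≤ k) (hΓ : HasValency Γ k)
    (hl : ¬ UniqueLifting Γ π) :
    ∃ v a a' b b', ({a, a', b, b'} : Set V) ⊆ Γ.neighborSet v ∧
      ({a, a', b, b'} : Set V).encard = 4 ∧ π a' = π a ∧ π b' = π b ∧ π a ≠ π b := by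
  have hf : 2 < Nat.card X := by omega
  have : Nontrivial X := Finite.one_lt_card_iff_nontrivial.1 (by omega)
  have hff : 2 < (Set.univ : Set X).ncard := by rwa [Set.ncard_univ]
  obtain ⟨x, y, z, -, -, -, hxy, hxz, hyz⟩ := (Set.two_lt_ncard_iff (Set.toFinite _)).1 hff
  obtain ⟨v, a, b, ha, hb, hab⟩ := h.exists_adj_of_connected hc hxy hxz hyz
  obtain ⟨a', haa, ha', hpa⟩ := h.exists_ne_of_not_uniqueLifting hk hΓ hl ha
  obtain ⟨b', hbb, hb', hpb⟩ := h.exists_ne_of_not_uniqueLifting hk hΓ hl hb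
  refine ⟨v, a, a', b, b', ?_, ?_, hpa, hpb, hab⟩
  · simp only [Set.insert_subset_iff, Set.singleton_subset_iff]
    exact ⟨ha, ha', hb, hb'⟩
  · have h1 : a ≠ b := fun e => hab (congrArg π e)
    have h2 : a ≠ b' := fun e => hab (by rw [e, hpb])
    have h3 : a' ≠ b := fun e => hab (by rw [← e, hpa])
    have h4 : a' ≠ b' := fun e => hab (by rw [← hpa, e, hpb])
    rw [Set.encard_insert_of_notMem (by simp [haa.symm, h1, h2]),
      Set.encard_insert_of_notMem (by simp [h3, h4]), Set.encard_pair hbb.symm]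
    norm_num

theorem not_isSymmetricPseudocover_four {V : Type*} {Γ : SimpleGraph V} (hc : Γ.Connected) :
    ¬ IsSymmetricPseudocover Γ (K 4) := by
  rintro ⟨G, r, harc, hb, ⟨e⟩, hp⟩
  obtain ⟨φ, hφ, -⟩ := exists_blockAction harc hb e
  obtain ⟨⟨k, hk, hΓ⟩, hl⟩ := (isPseudocoverOfQuotient_iff e).1 hp
  rw [isCoverOfQuotient_iff hφ.surjective
    (fun v w => (e.injective.eq_iff.trans Quotient.eq).symm) hφ.map_ne hφ.exists_adj] at hl
  have hk' := hk
  rw [Nat.card_fin] at hk'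
  obtain ⟨v, a, a', b, b', hsub, hcard, -⟩ :=
    hφ.exists_four_neighbors hc hk (by omega) hΓ hl
  have := Set.encard_le_encard hsub
  rw [hcard, hΓ v] at this
  have : 4 ≤ k := by exact_mod_cast this
  omega

end Pseudocovers

theorem isCosetPair_pseudocover :
    IsCosetPair (0 : Fin 5) 1 (pointedCentralizer 0 (swap 1 2)) (swap 0 1 * swap 2 3) where
  mul_self := by decide
  apply_base := by decide
  ne := by decide
  apply_of_mem p hp := (mem_pointedCentralizer.1 hp).1
  exists_notMem := ⟨swap 2 3, by decide, by rw [mem_pointedCentralizer]; decide⟩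
  eq_top K hL hγ := by
    have h12 : swap 1 2 ∈ K := hL (by rw [mem_pointedCentralizer]; decide)
    have h34 : swap 3 4 ∈ K := hL (by rw [mem_pointedCentralizer]; decide)
    have h03 : swap 0 3 ∈ K := by
      convert K.mul_mem (K.mul_mem hγ h12) hγ using 1
      decide
    have h04 : swap 0 4 ∈ K := by
      convert K.mul_mem (K.mul_mem h34 h03) h34 using 1
      decide
    have h24 : swap 2 4 ∈ K := by
      -- `swap 3 4 * γ` is `swap 0 1` times a disjoint 3-cycle, so its cube is `swap 0 1`.
      have h := K.pow_mem (K.mul_mem h34 hγ) 3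
      have h01 : swap 0 1 ∈ K := by
        convert h using 1
        decide
      have h02 : swap 0 2 ∈ K := by
        convert K.mul_mem (K.mul_mem h12 h01) h12 using 1
        decide
      convert K.mul_mem (K.mul_mem h02 h04) h02 using 1
      decide
    have h13 : swap 1 3 ∈ K := by
      convert K.mul_mem (K.mul_mem (K.mul_mem (K.mul_mem h12 h34) h24) h34) h12 using 1
      decide
    have h14 : swap 1 4 ∈ K := by
      convert K.mul_mem (K.mul_mem h34 h13) h34 using 1
      decide
    have h01 : swap 0 1 ∈ K := by
      convert K.mul_mem (K.mul_mem h13 h03) h13 using 1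
      decide
    refine eq_top_of_swap_mem (by decide) h01 fun j hj => ?_
    fin_cases j
    · exact absurd rfl hj
    · exact ⟨1, K.one_mem, rfl, rfl⟩
    · exact ⟨_, h12, by decide, by decide⟩
    · exact ⟨_, h13, by decide, by decide⟩
    · exact ⟨_, h14, by decide, by decide⟩

theorem natCard_pointedCentralizer_swap :
    Nat.card (pointedCentralizer (0 : Fin 5) (swap 1 2)) = 4 := by
  rw [natCard_eq_of_mem_iff mem_pointedCentralizer]
  decide +kernel

/-- `L` meets its conjugate by `γ` trivially, so the four elements of `L` give four distinct
neighbours. -/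
theorem hasValency_pseudocover : HasValency (cosetGraph isCosetPair_pseudocover) 4 := by
  have hp := isCosetPair_pseudocover
  have hbase : ((cosetGraph hp).neighborSet ((1 : Perm (Fin 5)) : Perm (Fin 5) ⧸ _)).encard = 4 := by
    have hset : (cosetGraph hp).neighborSet ((1 : Perm (Fin 5)) : Perm (Fin 5) ⧸ _) =
        (fun p : Perm (Fin 5) => ((p * (swap 0 1 * swap 2 3) : Perm (Fin 5)) :
          Perm (Fin 5) ⧸ pointedCentralizer (0 : Fin 5) (swap 1 2))) ''
            (pointedCentralizer (0 : Fin 5) (swap 1 2) : Set (Perm (Fin 5))) := by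
      ext a
      exact hp.adj_mk_one_iff a
    rw [hset, Set.InjOn.encard_image, Set.encard, ENat.card_eq_coe_natCard]
    · exact congrArg _ natCard_pointedCentralizer_swap
    · intro p h1 q h2 hpq
      have key : ∀ p : Perm (Fin 5), (p 0 = 0 ∧ p * swap 1 2 = swap 1 2 * p) →
          ((swap 0 1 * swap 2 3)⁻¹ * p * (swap 0 1 * swap 2 3) : Perm (Fin 5)) 0 = 0 ∧
          (swap 0 1 * swap 2 3)⁻¹ * p * (swap 0 1 * swap 2 3) * swap 1 2 =
            swap 1 2 * ((swap 0 1 * swap 2 3)⁻¹ * p * (swap 0 1 * swap 2 3)) → p = 1 := by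
        decide +kernel
      have hconj : (p * (swap 0 1 * swap 2 3))⁻¹ * (q * (swap 0 1 * swap 2 3)) =
          (swap 0 1 * swap 2 3)⁻¹ * (p⁻¹ * q) * (swap 0 1 * swap 2 3) := by
        simp only [mul_inv_rev, mul_assoc]
      rw [QuotientGroup.eq, hconj, mem_pointedCentralizer] at hpq
      have h3 := Subgroup.mul_mem _ (Subgroup.inv_mem _ h1) h2
      rw [mem_pointedCentralizer] at h3
      exact inv_mul_eq_one.1 (key _ h3 hpq)
  intro a
  obtain ⟨s, rfl⟩ := hp.locallyTransitive.exists_smul_eq hp.connected a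
  refine Eq.trans ?_ (((MulAction.injective s).encard_image _).trans hbase)
  congr 1
  ext b
  simp only [SimpleGraph.mem_neighborSet, Set.mem_image]
  constructor
  · intro hb
    refine ⟨s⁻¹ • b, ?_, smul_inv_smul _ _⟩
    rw [← adj_smul_iff hp.locallyTransitive.adj_smul s, smul_inv_smul]
    exact hb
  · rintro ⟨c, hc, rfl⟩
    exact hp.locallyTransitive.adj_smul s hc

/-- `L` preserves `{1, 2}`, so the base coset has no neighbour over 3. -/
theorem not_uniqueLifting_pseudocover :
    ¬ UniqueLifting (cosetGraph isCosetPair_pseudocover) (cosetProj isCosetPair_pseudocover) := by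
  intro h
  obtain ⟨w, ⟨hw, hw3⟩, -⟩ := h ((1 : Perm (Fin 5)) : Perm (Fin 5) ⧸ _) 3 (by
    rw [IsCosetPair.cosetProj_mk]; decide)
  rw [IsCosetPair.adj_mk_one_iff] at hw
  obtain ⟨p, hp, rfl⟩ := hw
  rw [IsCosetPair.cosetProj_mk] at hw3
  rw [mem_pointedCentralizer] at hp
  revert p
  decide +kernel

section Classification

variable {V A : Type*} [Group A] [MulAction A V] {Γ : SimpleGraph V} {φ : A →* Perm (Fin 5)}
  {π : V → Fin 5} {v₀ : V} {g : A}

theorem BlockAction.nonempty_iso_pseudocover (h : BlockAction Γ φ π) (hφ : Function.Injective φ)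
    (hc : Γ.Connected) (hfix : fixer φ v₀ = pointedCentralizer 0 (swap 1 2))
    (hadj : Γ.Adj v₀ (g • v₀)) (hg : φ g = swap 0 1 * swap 2 3) :
    Nonempty (Γ ≃g cosetGraph isCosetPair_pseudocover) := by
  refine (h.locallyTransitive hadj).nonempty_iso hc isCosetPair_pseudocover.locallyTransitive
    isCosetPair_pseudocover.connected φ (fun a => ?_) (by rw [hg]) (fun p hp => ?_)
  · rw [IsCosetPair.smul_mk_one_eq_iff, ← hfix, apply_mem_fixer_iff hφ]
  · rw [IsCosetPair.smul_mk_one_eq_iff, ← hfix] at hp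
    obtain ⟨a, ha, rfl⟩ := hp
    exact ⟨a, ha, rfl⟩

/-- The fixer preserves `{1, 2}`, so it lies in `⟨(1 2), (3 4)⟩` of order 4; being transitive on
four neighbours, it is this whole group and acts regularly. An element `g` reversing an arc is
therefore an involution. It cannot commute with `(3 4)`, as otherwise no vertex over 3 would be
reached. The two remaining choices are conjugate under `(3 4)`. -/
theorem BlockAction.nonempty_iso_pseudocover_of_neighbors (h : BlockAction Γ φ π)
    (hφ : Function.Injective φ) (hc : Γ.Connected) {a a' b b' : V}
    (hN : Γ.neighborSet v₀ = {a, a', b, b'}) (hcard : ({a, a', b, b'} : Set V).encard = 4)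
    (hv : π v₀ = 0) (ha : π a = 1) (ha' : π a' = 1) (hb : π b = 2) (hb' : π b' = 2) :
    Nonempty (Γ ≃g cosetGraph isCosetPair_pseudocover) := by
  have hmemN : ∀ w, Γ.Adj v₀ w ↔ w = a ∨ w = a' ∨ w = b ∨ w = b' := fun w => by
    rw [← SimpleGraph.mem_neighborSet, hN]; simp
  have hπN : ∀ w, Γ.Adj v₀ w → π w = 1 ∨ π w = 2 := by
    intro w hw
    rcases (hmemN w).1 hw with rfl | rfl | rfl | rfl <;> simp [*]
  have haN : Γ.Adj v₀ a := (hmemN a).2 (Or.inl rfl)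
  have hbN : Γ.Adj v₀ b := (hmemN b).2 (Or.inr (Or.inr (Or.inl rfl)))
  have hstab : ∀ {s : A}, s • v₀ = v₀ → ∀ {w}, Γ.Adj v₀ w → Γ.Adj v₀ (s • w) := by
    intro s hs w hw
    have := h.adj_smul s hw
    rwa [hs] at this
  have hle : fixer φ v₀ ≤ pointedCentralizer 0 (swap 1 2) := by
    rintro _ ⟨s, hs, rfl⟩
    have h1 := hπN _ (hstab hs haN)
    have h2 := hπN _ (hstab hs hbN)
    have h0 : φ s 0 = 0 := by rw [← hv, ← h.map_smul, show s • v₀ = v₀ from hs]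
    rw [h.map_smul, ha] at h1
    rw [h.map_smul, hb] at h2
    rw [mem_pointedCentralizer]
    have : ∀ p : Perm (Fin 5), p 0 = 0 → (p 1 = 1 ∨ p 1 = 2) → (p 2 = 1 ∨ p 2 = 2) →
        p 0 = 0 ∧ p * swap 1 2 = swap 1 2 * p := by
      decide +kernel
    exact this _ h0 h1 h2
  have hcardN : Nat.card (Γ.neighborSet v₀) = 4 := by
    rw [Nat.card_coe_set_eq, Set.ncard, hN, hcard]; rfl
  -- The preimage under `φ` is chosen, but injectivity of `φ` makes it unique.
  let F : fixer φ v₀ → Γ.neighborSet v₀ := fun p =>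
    ⟨p.2.choose • a, hstab p.2.choose_spec.1 haN⟩
  have hF : ∀ (s : A) (hs : s • v₀ = v₀), F ⟨φ s, s, hs, rfl⟩ = ⟨s • a, hstab hs haN⟩ := by
    intro s hs
    have hmem : φ s ∈ fixer φ v₀ := ⟨s, hs, rfl⟩
    have := hφ hmem.choose_spec.2
    exact Subtype.ext (congrArg (· • a) this)
  have hsurj : Function.Surjective F := by
    rintro ⟨w, hw⟩
    obtain ⟨s, hs, rfl⟩ := h.arc_transitive haN hw
    exact ⟨_, hF s hs⟩
  have hcard1 : Nat.card (fixer φ v₀) ≤ 4 := by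
    rw [← natCard_pointedCentralizer_swap]
    exact Subgroup.card_le_of_le hle
  have hbij := hsurj.bijective_of_nat_card_le (by rw [hcardN]; exact hcard1)
  have hfix : fixer φ v₀ = pointedCentralizer 0 (swap 1 2) := by
    apply Subgroup.eq_of_le_of_card_ge hle
    rw [natCard_pointedCentralizer_swap, ← hcardN]
    exact (Nat.card_eq_of_bijective F hbij).ge
  have hone : ∀ s : A, s • v₀ = v₀ → s • a = a → s = 1 := by
    intro s hs hsa
    have h1 := hF s hs
    have h2 := hF 1 (one_smul _ _)
    have h3 : F ⟨φ s, s, hs, rfl⟩ = F ⟨φ 1, 1, one_smul _ _, rfl⟩ := by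
      rw [h1, h2]
      exact Subtype.ext (hsa.trans (one_smul _ _).symm)
    exact hφ (congrArg Subtype.val (hbij.1 h3))
  obtain ⟨g, hg, hg'⟩ := h.arc_transitive haN haN.symm
  have hgg : g * g = 1 := hone _ (by rw [mul_smul, hg, hg']) (by rw [mul_smul, hg', hg])
  have hadj : Γ.Adj v₀ (g • v₀) := by rw [hg]; exact haN
  have hg0 : φ g 0 = 1 := by rw [← hv, ← h.map_smul, hg, ha]
  have hg1 : φ g 1 = 0 := by rw [← ha, ← h.map_smul, hg', hv]
  -- An involution is its own cube, which makes `cube_of_swapping` applicable.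
  have hg3 : φ g = φ g ^ 3 := by
    rw [pow_succ, pow_two, ← map_mul, hgg, map_one, one_mul]
  have hcomm : φ g ∉ Subgroup.centralizer {swap 3 4} := by
    intro hgc
    have key : ∀ p : Perm (Fin 5), p * swap 3 4 = swap 3 4 * p → p 0 ≠ 3 := by decide +kernel
    have hLc : ∀ p : Perm (Fin 5), (p 0 = 0 ∧ p * swap 1 2 = swap 1 2 * p) →
        p * swap 3 4 = swap 3 4 * p := by decide +kernel
    obtain ⟨w, hw⟩ := h.surjective 3
    obtain ⟨t, ht, rfl⟩ := exists_mem_smul_eq hc h.adj_smul v₀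
      ((Subgroup.centralizer {swap 3 4}).comap φ) (fun w hw => by
        obtain ⟨s, hs, rfl⟩ := h.arc_transitive hadj hw
        refine ⟨s * g, Subgroup.mul_mem _ ?_ hgc, by rw [mul_smul]⟩
        have : φ s ∈ pointedCentralizer 0 (swap 1 2) := hle ⟨s, hs, rfl⟩
        exact Subgroup.mem_centralizer_singleton_iff.2 (hLc _ (mem_pointedCentralizer.1 this))) w
    rw [h.map_smul, hv] at hw
    exact key _ (Subgroup.mem_centralizer_singleton_iff.1 ht) hw
  rw [Subgroup.mem_centralizer_singleton_iff] at hcomm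
  rcases cube_of_swapping (φ g) hg0 hg1 with e | e | e | e <;> rw [← hg3] at e
  · rw [e] at hcomm
    exact absurd (by decide) hcomm
  · exact h.nonempty_iso_pseudocover hφ hc hfix hadj e
  · refine (h.relabel (swap 3 4)).nonempty_iso_pseudocover
      ((MulAut.conj (swap 3 4)).injective.comp hφ) hc ?_ hadj ?_
    · rw [fixer, ← Subgroup.map_map, ← fixer, hfix]
      ext p
      rw [Subgroup.mem_map_equiv, mem_pointedCentralizer, mem_pointedCentralizer]
      change (((swap 3 4)⁻¹ * p * swap 3 4 : Perm (Fin 5)) 0 = 0 ∧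
        ((swap 3 4)⁻¹ * p * swap 3 4) * _ = _ * ((swap 3 4)⁻¹ * p * swap 3 4)) ↔ _
      revert p
      decide +kernel
    · change swap 3 4 * φ g * (swap 3 4)⁻¹ = _
      rw [e]; decide
  · rw [e] at hcomm
    exact absurd (by decide) hcomm

end Classification

theorem connected_and_isFaithfulArcTransitivePseudocover_iff {V : Type*} {Γ : SimpleGraph V} :
    (Γ.Connected ∧ IsFaithfulArcTransitivePseudocover Γ (K 5)) ↔
      Nonempty (Γ ≃g cosetGraph isCosetPair_pseudocover) := by
  constructor
  · rintro ⟨hc, G, r, harc, hb, hf, ⟨e⟩, hp⟩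
    obtain ⟨φ, hφ, hinj⟩ := exists_blockAction harc hb e
    obtain ⟨⟨k, hk, hΓ⟩, hl⟩ := (isPseudocoverOfQuotient_iff e).1 hp
    rw [isCoverOfQuotient_iff hφ.surjective
      (fun v w => (e.injective.eq_iff.trans Quotient.eq).symm) hφ.map_ne hφ.exists_adj] at hl
    have hk' := hk
    rw [Nat.card_fin] at hk'
    obtain rfl : k = 4 := by omega
    obtain ⟨v, a, a', b, b', hsub, hcard, ha', hb', hab⟩ :=
      hφ.exists_four_neighbors hc hk (by omega) hΓ hl
    have hN : Γ.neighborSet v = {a, a', b, b'} := by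
      symm
      apply Set.Finite.eq_of_subset_of_encard_le (Set.finite_of_encard_eq_coe (k := 4) hcard) hsub
      rw [hcard, hΓ v]; rfl
    have hτ : ∀ x y z : Fin 5, x ≠ y → x ≠ z → y ≠ z →
        ∃ τ : Perm (Fin 5), τ x = 0 ∧ τ y = 1 ∧ τ z = 2 := by
      decide +kernel
    obtain ⟨τ, h0, h1, h2⟩ := hτ _ _ _ (hφ.map_ne (hsub (show a ∈ _ by simp)))
      (hφ.map_ne (hsub (show b ∈ _ by simp))) hab
    refine (hφ.relabel τ).nonempty_iso_pseudocover_of_neighbors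
      ((MulAut.conj τ).injective.comp (hinj hf)) hc hN hcard h0 h1 ?_ h2 ?_
    · exact (congrArg τ ha').trans h1
    · exact (congrArg τ hb').trans h2
  · rintro ⟨e⟩
    exact ⟨e.connected_iff.2 isCosetPair_pseudocover.connected,
      isFaithfulArcTransitivePseudocover_of_iso e isCosetPair_pseudocover.blockAction
        Function.injective_id (by simp) hasValency_pseudocover not_uniqueLifting_pseudocover⟩

/-! ### Models on `Fin m` and the final counts -/

theorem exists_iso_fin {W : Type*} [Finite W] (Δ : SimpleGraph W) :
    ∃ (m : ℕ) (C : SimpleGraph (Fin m)), Nonempty (Δ ≃g C) := by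
  obtain ⟨m, ⟨e⟩⟩ := Finite.exists_equiv_fin W
  exact ⟨m, Δ.map e.toEmbedding, ⟨SimpleGraph.Iso.map e Δ⟩⟩

theorem nonempty_iso_congr {V W W' : Type*} {Γ : SimpleGraph V} {Δ : SimpleGraph W}
    {C : SimpleGraph W'} (f : Δ ≃g C) : Nonempty (Γ ≃g Δ) ↔ Nonempty (Γ ≃g C) :=
  ⟨fun ⟨e⟩ => ⟨e.trans f⟩, fun ⟨e⟩ => ⟨e.trans f.symm⟩⟩

/-- There is exactly one connected faithful arc-transitive pseudocover of `K 5`. -/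
theorem exists_pseudocover_five :
    ∃ (m : ℕ) (P : SimpleGraph (Fin m)), ∀ (V : Type u) [Finite V] (Γ : SimpleGraph V),
      (Γ.Connected ∧ IsFaithfulArcTransitivePseudocover Γ (K 5)) ↔ Nonempty (Γ ≃g P) := by
  obtain ⟨m, C, ⟨f⟩⟩ := exists_iso_fin (cosetGraph isCosetPair_pseudocover)
  exact ⟨m, C, fun V _ Γ => connected_and_isFaithfulArcTransitivePseudocover_iff.trans
    (nonempty_iso_congr f)⟩

/-- There are exactly five connected faithful arc-transitive covers of `K 5`. -/
theorem exists_covers_five :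
    ∃ (m : Fin 5 → ℕ) (C : (i : Fin 5) → SimpleGraph (Fin (m i))),
      (∀ i j : Fin 5, i ≠ j → IsEmpty (C i ≃g C j)) ∧
      ∀ (V : Type u) [Finite V] (Γ : SimpleGraph V),
        (Γ.Connected ∧ IsFaithfulArcTransitiveCover Γ (K 5)) ↔
          ∃ i : Fin 5, Nonempty (Γ ≃g C i) := by
  obtain ⟨m₀, C₀, ⟨f₀⟩⟩ := exists_iso_fin (cosetGraph isCoverPair_alternating.toIsCosetPair)
  obtain ⟨m₁, C₁, ⟨f₁⟩⟩ := exists_iso_fin (cosetGraph isCoverPair_dihedral.toIsCosetPair)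
  obtain ⟨m₂, C₂, ⟨f₂⟩⟩ := exists_iso_fin (cosetGraph isCoverPair_klein.toIsCosetPair)
  obtain ⟨m₃, C₃, ⟨f₃⟩⟩ := exists_iso_fin (cosetGraph isCoverPair_cyclic_swap.toIsCosetPair)
  obtain ⟨m₄, C₄, ⟨f₄⟩⟩ :=
    exists_iso_fin (cosetGraph isCoverPair_cyclic_swap_mul_swap.toIsCosetPair)
  have hm₀ : m₀ = 10 := by
    rw [← Nat.card_fin m₀, ← Nat.card_congr f₀.toEquiv]
    exact natCard_quotient_eq (by rw [natCard_pointedAlternating])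
      (by rw [natCard_pointedAlternating]; decide)
  have hm₁ : m₁ = 15 := by
    rw [← Nat.card_fin m₁, ← Nat.card_congr f₁.toEquiv]
    exact natCard_quotient_eq (by rw [natCard_pointedCentralizer_sq])
      (by rw [natCard_pointedCentralizer_sq]; decide)
  have hm₂ : m₂ = 30 := by
    rw [← Nat.card_fin m₂, ← Nat.card_congr f₂.toEquiv]
    exact natCard_quotient_eq (by rw [natCard_kleinGroup]) (by rw [natCard_kleinGroup]; decide)
  have hm₃ : m₃ = 30 := by
    rw [← Nat.card_fin m₃, ← Nat.card_congr f₃.toEquiv]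
    exact natCard_quotient_eq (by rw [natCard_pointedCentralizer_fourCycle])
      (by rw [natCard_pointedCentralizer_fourCycle]; decide)
  have hm₄ : m₄ = 30 := by
    rw [← Nat.card_fin m₄, ← Nat.card_congr f₄.toEquiv]
    exact natCard_quotient_eq (by rw [natCard_pointedCentralizer_fourCycle])
      (by rw [natCard_pointedCentralizer_fourCycle]; decide)
  let σ : Fin 5 → Σ m, SimpleGraph (Fin m) :=
    ![⟨m₀, C₀⟩, ⟨m₁, C₁⟩, ⟨m₂, C₂⟩, ⟨m₃, C₃⟩, ⟨m₄, C₄⟩]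
  have hne : ∀ i j : Fin 5, i < j → IsEmpty ((σ i).2 ≃g (σ j).2) := by
    have hcard : ∀ {m n : ℕ} {C : SimpleGraph (Fin m)} {D : SimpleGraph (Fin n)}, m ≠ n →
        IsEmpty (C ≃g D) := fun h => ⟨fun e => h (by simpa using Nat.card_congr e.toEquiv)⟩
    have h23 : IsEmpty (C₂ ≃g C₃) := ⟨fun e => not_hasClosedFiveWalk_klein
      (hasClosedFiveWalk_cyclic_swap.of_iso ((f₂.trans e).trans f₃.symm).symm)⟩
    have h24 : IsEmpty (C₂ ≃g C₄) := ⟨fun e => not_hasTriangle_klein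
      (hasTriangle_cyclic_swap_mul_swap.of_iso ((f₂.trans e).trans f₄.symm).symm)⟩
    have h34 : IsEmpty (C₃ ≃g C₄) := ⟨fun e => not_hasTriangle_cyclic_swap
      (hasTriangle_cyclic_swap_mul_swap.of_iso ((f₃.trans e).trans f₄.symm).symm)⟩
    intro i j hij
    fin_cases i <;> fin_cases j <;>
      first
      | exact absurd hij (by decide)
      | exact h23
      | exact h24
      | exact h34
      | exact hcard (show m₀ ≠ m₁ by omega)
      | exact hcard (show m₀ ≠ m₂ by omega)
      | exact hcard (show m₀ ≠ m₃ by omega)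
      | exact hcard (show m₀ ≠ m₄ by omega)
      | exact hcard (show m₁ ≠ m₂ by omega)
      | exact hcard (show m₁ ≠ m₃ by omega)
      | exact hcard (show m₁ ≠ m₄ by omega)
  refine ⟨fun i => (σ i).1, fun i => (σ i).2, fun i j hij => ?_, fun V _ Γ => ?_⟩
  · rcases lt_or_gt_of_ne hij with h | h
    · exact hne i j h
    · exact ⟨fun e => (hne j i h).false e.symm⟩
  · rw [connected_and_isFaithfulArcTransitiveCover_iff, IsListedCover, nonempty_iso_congr f₀,
      nonempty_iso_congr f₁, nonempty_iso_congr f₂, nonempty_iso_congr f₃, nonempty_iso_congr f₄,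
      Fin.exists_fin_succ, Fin.exists_fin_succ, Fin.exists_fin_succ, Fin.exists_fin_succ,
      Fin.exists_fin_one]
    rfl

end GraphCover

theorem mainTheorem5 :
    -- `K₄` has no connected symmetric pseudocover
    (∀ (V : Type u) [Finite V] (Γ : SimpleGraph V), Γ.Connected →
      ¬ GraphCover.IsSymmetricPseudocover Γ (GraphCover.K 4)) ∧
    -- the cube is the unique connected `G`-arc-transitive cover of `K₄` with `G ≤ S₄`
    (∀ (V : Type u) [Finite V] (Γ : SimpleGraph V),
      (Γ.Connected ∧ GraphCover.IsFaithfulArcTransitiveCover Γ (GraphCover.K 4)) ↔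
        Nonempty (Γ ≃g GraphCover.cubeGraph)) ∧
    -- `K₅` has exactly one connected `G`-arc-transitive pseudocover with `G ≤ S₅`
    (∃ (m : ℕ) (P : SimpleGraph (Fin m)), ∀ (V : Type u) [Finite V] (Γ : SimpleGraph V),
      (Γ.Connected ∧ GraphCover.IsFaithfulArcTransitivePseudocover Γ (GraphCover.K 5)) ↔
        Nonempty (Γ ≃g P)) ∧
    -- `K₅` has exactly five connected `G`-arc-transitive covers with `G ≤ S₅`
    (∃ (m : Fin 5 → ℕ) (C : (i : Fin 5) → SimpleGraph (Fin (m i))),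
      (∀ i j : Fin 5, i ≠ j → IsEmpty (C i ≃g C j)) ∧
      ∀ (V : Type u) [Finite V] (Γ : SimpleGraph V),
        (Γ.Connected ∧ GraphCover.IsFaithfulArcTransitiveCover Γ (GraphCover.K 5)) ↔
          ∃ i : Fin 5, Nonempty (Γ ≃g C i)) := by
  exact ⟨fun V _ Γ hc => GraphCover.not_isSymmetricPseudocover_four hc,
    fun V _ Γ => GraphCover.connected_and_isFaithfulArcTransitiveCover_four_iff,
    GraphCover.exists_pseudocover_five, GraphCover.exists_covers_five⟩
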